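/- Let $D$ be the open unit disc in $\mathbb R^2$ and, for $0\le r<1$, let $\Phi_r(\theta)=\dfrac{1-r^2}{2\pi(1-2r\cos\theta+r^2)}$. For a $2\pi$-periodic $g:\mathbb R\to\mathbb R$ let $P[g](re^{i\theta})=\int_{-\pi}^{\pi}g(\phi)\,\Phi_r(\phi-\theta)\,d\phi$ be its Poisson integral on $D$, and for $u:D\to\mathbb R$ write $u_r(\theta)=u(re^{i\theta})$. Let $Vg$ be the variation of $g$ over one period, $\mathcal{BV}$ the set of $2\pi$-periodic $g:\mathbb R\to\mathbb R$ with $Vg<\infty$, and $\mathcal{NBV}$ the space of $g\in\mathcal{BV}$ that are right continuous and satisfy $g(-\pi)=0$, with norm $Vg$. Let $\mathcal{HK}$ be the set of $2\pi$-periodic $f:\mathbb R\to\mathbb R$ that are Henstock--Kurzweil integrable over $[-\pi,\pi]$. Weak* convergence to $g\in\mathcal{NBV}$ is understood with respect to the pairing $\int_{-\pi}^{\pi}fg$, $f\in\mathcal{HK}$ (a Henstock--Kurzweil integral). Let $h^{\mathcal{BV}}$ be the space of harmonic $u:D\to\mathbb R$ with $\|u\|_{\mathcal{BV}}:=\sup_{0\le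 r<1}Vu_r<\infty$. Since $\|u\|_{\mathcal{BV}}=0$ exactly when $u$ is constant, functions in $h^{\mathcal{BV}}$ that differ by a constant are identified when $h^{\mathcal{BV}}$ is regarded as a normed space. **Theorem.** Let $g\in\mathcal{BV}$ and $v=P[g]$. (a) If $g\in\mathcal{NBV}$ then $v_r\to g$ weak* as $r\to1^-$: for every $f\in\mathcal{HK}$, the products $fg$ and $fv_r$ ($0\le r<1$) are Henstock--Kurzweil integrable over $[-\pi,\pi]$ and $\int_{-\pi}^{\pi}fv_r\to\int_{-\pi}^{\pi}fg$. (b) $\|v_r\|_\infty\le\inf|g|+Vg$ for all $0\le r<1$. (c) If $g\in\mathcal{NBV}$ then $\|v_r\|_\infty\le Vg$ for all $0\le r<1$. (d) $Vv_r\le Vg$ for all $0\le r<1$. (e) Convergence in variation can fail: there is $\sigma\in\mathcal{NBV}$ such that, with $w=P[\sigma]$, $V(w_r-\sigma)\not\to0$ as $r\to1^-$. Also, there is $\tau\in\mathcal{BV}$ with $\tau(\theta)=[\tau(\theta+)+\tau(\theta-)]/2$ for all $\theta$ such that, with $w=P[\tau]$, $V(w_r-\tau)\not\to0$ as $r\to1^-$.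 (f) The seminorm $\|\cdot\|_{\mathcal{BV}}$ on $h^{\mathcal{BV}}$ vanishes exactly on the constants. With functions that differ by a constant identified, $h^{\mathcal{BV}}$ is a Banach space; $\mathcal{NBV}$ is a Banach space; and $g\mapsto P[g]$ maps $\mathcal{NBV}$ into $h^{\mathcal{BV}}$ and induces a linear isometric isomorphism of $\mathcal{NBV}$ onto this Banach space. -/

import Mathlib

open Set Filter Topology MeasureTheory InnerProductSpace
open scoped ENNReal

noncomputable section

namespace PoissonBV

/-! ### The Poisson integral -/

/-- The open unit disc `D` of the complex plane, as a type. -/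
abbrev Disc : Type := Metric.ball (0 : ℂ) 1

/-- The Poisson kernel `Φ_r(θ) = (1 - r²) / (2π (1 - 2 r cos θ + r²))`. -/
def polarPoissonKernel (r θ : ℝ) : ℝ :=
  (1 - r ^ 2) / (2 * Real.pi * (1 - 2 * r * Real.cos θ + r ^ 2))

/-- The Poisson integral `P[g](r e^{iθ}) = ∫_{-π}^{π} g(φ) Φ_r(φ - θ) dφ`, for `g` integrable on a
period (in particular for `g` of bounded variation). Here `r = |z|` and `θ = arg z`; the kernel is
`2π`-periodic in `θ`, and does not depend on `θ` at the origin. -/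
def poissonIntegral (g : ℝ → ℝ) (z : Disc) : ℝ :=
  ∫ φ in (-Real.pi)..Real.pi, g φ * polarPoissonKernel ‖(z : ℂ)‖ (φ - Complex.arg (z : ℂ))

open Classical in
/-- The extension by zero of a function on the disc to the whole plane. -/
def extendZero (u : Disc → ℝ) (z : ℂ) : ℝ :=
  if h : z ∈ Metric.ball (0 : ℂ) 1 then u ⟨z, h⟩ else 0

/-- `u_r(θ) = u(r e^{iθ})`, meaningful for `0 ≤ r < 1`. -/
def slice (u : Disc → ℝ) (r θ : ℝ) : ℝ :=
  extendZero u (circleMap 0 r θ)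

/-- `u : D → ℝ` is harmonic in the (open) disc. -/
def IsHarmonicOnDisc (u : Disc → ℝ) : Prop :=
  HarmonicOnNhd (extendZero u) (Metric.ball (0 : ℂ) 1)

/-! ### Bounded variation -/

/-- The variation `V g` of `g` over one period, as an extended nonnegative real. -/
def variation (g : ℝ → ℝ) : ℝ≥0∞ :=
  eVariationOn g (Icc (-Real.pi) Real.pi)

/-- The class `BV` of `2π`-periodic functions with finite variation over one period. -/
def IsBV (g : ℝ → ℝ) : Prop :=
  Function.Periodic g (2 * Real.pi) ∧ variation g < ∞

lemma variation_zero : variation 0 = 0 :=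
  eVariationOn.constant_on (f := (0 : ℝ → ℝ)) (by
    rintro _ ⟨x, -, rfl⟩ _ ⟨y, -, rfl⟩
    rfl)

lemma variation_add_le (f g : ℝ → ℝ) : variation (f + g) ≤ variation f + variation g := by
  refine iSup_le fun p => ?_
  calc ∑ i ∈ Finset.range p.1, edist ((f + g) (p.2.1 (i + 1))) ((f + g) (p.2.1 i))
      ≤ ∑ i ∈ Finset.range p.1, (edist (f (p.2.1 (i + 1))) (f (p.2.1 i))
          + edist (g (p.2.1 (i + 1))) (g (p.2.1 i))) :=
        Finset.sum_le_sum fun i _ => edist_add_add_le _ _ _ _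
    _ ≤ variation f + variation g := by
        rw [Finset.sum_add_distrib]
        exact add_le_add (eVariationOn.sum_le p.2.2.1 p.2.2.2)
          (eVariationOn.sum_le p.2.2.1 p.2.2.2)

lemma variation_smul (c : ℝ) (f : ℝ → ℝ) : variation (c • f) = ‖c‖ₑ * variation f := by
  unfold variation eVariationOn
  rw [ENNReal.mul_iSup]
  refine iSup_congr fun p => ?_
  rw [Finset.mul_sum]
  refine Finset.sum_congr rfl fun i _ => ?_
  simp only [Pi.smul_apply, smul_eq_mul, edist_eq_enorm_sub, ← mul_sub, enorm_mul]

lemma variation_neg (f : ℝ → ℝ) : variation (-f) = variation f := by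
  have h := variation_smul (-1) f
  simpa using h

/-! ### The space `NBV` of functions of normalised bounded variation -/

/-- `NBV`, as a linear space of functions: `g` is `2π`-periodic, of finite variation over one
period, `g(-π) = 0`, and `g` is right continuous. -/
def nbv : Submodule ℝ (ℝ → ℝ) where
  carrier := {g | IsBV g ∧ g (-Real.pi) = 0 ∧ ∀ x, ContinuousWithinAt g (Ici x) x}
  zero_mem' := ⟨⟨fun _ => rfl, by rw [variation_zero]; exact ENNReal.zero_lt_top⟩, rfl,
    fun _ => continuousWithinAt_const⟩
  add_mem' := by
    rintro f g ⟨⟨hf, hfv⟩, hf0, hfc⟩ ⟨⟨hg, hgv⟩, hg0, hgc⟩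
    refine ⟨⟨hf.add hg, (variation_add_le f g).trans_lt (ENNReal.add_lt_top.2 ⟨hfv, hgv⟩)⟩, ?_,
      fun x => (hfc x).add (hgc x)⟩
    simp [hf0, hg0]
  smul_mem' := by
    rintro c f ⟨⟨hf, hfv⟩, hf0, hfc⟩
    refine ⟨⟨hf.smul c, ?_⟩, ?_, fun x => (hfc x).const_smul c⟩
    · rw [variation_smul]
      exact ENNReal.mul_lt_top enorm_lt_top hfv
    · simp [hf0]

/-- The space `NBV`. It is a separate type, so that its norm is the variation and its topology is
the one of this norm. -/
def NBV : Type := nbv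

instance : AddCommGroup NBV := inferInstanceAs (AddCommGroup nbv)

instance : Module ℝ NBV := inferInstanceAs (Module ℝ nbv)

/-- The function underlying an element of `NBV`. -/
def NBV.toFun (g : NBV) : ℝ → ℝ := Subtype.val (p := fun g => g ∈ nbv) g

/-- The variation `V g`, as a real number, is a norm on `NBV`. -/
def NBV.addGroupNorm : AddGroupNorm NBV where
  toFun g := (variation g.toFun).toReal
  map_zero' := by
    change (variation 0).toReal = 0
    simp [variation_zero]
  add_le' f g := by
    have hf : variation f.toFun < ∞ := f.2.1.2
    have hg : variation g.toFun < ∞ := g.2.1.2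
    rw [← ENNReal.toReal_add hf.ne hg.ne]
    exact ENNReal.toReal_mono (ENNReal.add_lt_top.2 ⟨hf, hg⟩).ne (variation_add_le _ _)
  neg' f := by
    change (variation (-f.toFun)).toReal = _
    rw [variation_neg]
  eq_zero_of_map_eq_zero' f h := by
    have hf : variation f.toFun < ∞ := f.2.1.2
    have h0 : variation f.toFun = 0 := (ENNReal.toReal_eq_zero_iff _).1 h |>.resolve_right hf.ne
    have hper : Function.Periodic f.toFun (2 * Real.pi) := f.2.1.1
    have hz : f.toFun (-Real.pi) = 0 := f.2.2.1
    refine Subtype.ext (funext fun x => ?_)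
    change f.toFun x = 0
    obtain ⟨y, hy, hxy⟩ := hper.exists_mem_Ico Real.two_pi_pos x (-Real.pi)
    have hy' : y ∈ Icc (-Real.pi) Real.pi := ⟨hy.1, by linarith [hy.2]⟩
    have hpi : -Real.pi ∈ Icc (-Real.pi) Real.pi := ⟨le_rfl, by linarith [Real.pi_pos]⟩
    have he := (eVariationOn.eq_zero_iff _).1 h0 y hy' _ hpi
    rw [hxy, ← hz]
    exact edist_eq_zero.1 he

instance : NormedAddCommGroup NBV := NBV.addGroupNorm.toNormedAddCommGroup

instance : NormedSpace ℝ NBV where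
  norm_smul_le c f := by
    change (variation (c • f.toFun)).toReal ≤ ‖c‖ * (variation f.toFun).toReal
    rw [variation_smul, ENNReal.toReal_mul, toReal_enorm]

/-! ### The harmonic Hardy space `h^BV` -/

/-- `‖u‖_BV = sup_{0 ≤ r < 1} V u_r`, as an extended nonnegative real. -/
def hardyVariation (u : Disc → ℝ) : ℝ≥0∞ :=
  ⨆ r ∈ Ico (0 : ℝ) 1, variation (slice u r)

lemma extendZero_add (u v : Disc → ℝ) : extendZero (u + v) = extendZero u + extendZero v := by
  ext z
  by_cases h : z ∈ Metric.ball (0 : ℂ) 1 <;> simp only [extendZero, Pi.add_apply, h, dite_true,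
    dite_false, add_zero]

lemma extendZero_smul (c : ℝ) (u : Disc → ℝ) : extendZero (c • u) = c • extendZero u := by
  ext z
  by_cases h : z ∈ Metric.ball (0 : ℂ) 1 <;> simp only [extendZero, Pi.smul_apply, h, dite_true,
    dite_false, smul_zero]

lemma extendZero_zero : extendZero 0 = 0 := by
  ext z
  simp [extendZero]

lemma hardyVariation_zero : hardyVariation 0 = 0 := by
  have h : ∀ r, slice 0 r = 0 := fun r => by
    funext θ
    simp [slice, extendZero_zero]
  simp [hardyVariation, h, variation_zero]

lemma hardyVariation_add_le (u v : Disc → ℝ) :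
    hardyVariation (u + v) ≤ hardyVariation u + hardyVariation v := by
  refine iSup₂_le fun r hr => ?_
  have h : slice (u + v) r = slice u r + slice v r := by
    funext θ
    simp [slice, extendZero_add]
  rw [h]
  exact (variation_add_le _ _).trans (add_le_add
    (le_iSup₂ (f := fun r (_ : r ∈ Ico (0 : ℝ) 1) => variation (slice u r)) r hr)
    (le_iSup₂ (f := fun r (_ : r ∈ Ico (0 : ℝ) 1) => variation (slice v r)) r hr))

lemma hardyVariation_smul (c : ℝ) (u : Disc → ℝ) :
    hardyVariation (c • u) = ‖c‖ₑ * hardyVariation u := by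
  have h : ∀ r, slice (c • u) r = c • slice u r := fun r => by
    funext θ
    simp [slice, extendZero_smul]
  simp only [hardyVariation, h, variation_smul, ENNReal.mul_iSup]

lemma hardyVariation_neg (u : Disc → ℝ) : hardyVariation (-u) = hardyVariation u := by
  have h := hardyVariation_smul (-1) u
  simpa using h

/-- `h^BV`, as a linear space of functions: `u : D → ℝ` is harmonic in `D`, with finite
`‖u‖_BV`. -/
def hbv : Submodule ℝ (Disc → ℝ) where
  carrier := {u | IsHarmonicOnDisc u ∧ hardyVariation u < ∞}
  zero_mem' := by
    refine ⟨?_, by rw [hardyVariation_zero]; exact ENNReal.zero_lt_top⟩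
    unfold IsHarmonicOnDisc
    rw [extendZero_zero]
    exact harmonicOnNhd_const 0
  add_mem' := by
    rintro u v ⟨hu, hu'⟩ ⟨hv, hv'⟩
    refine ⟨?_, (hardyVariation_add_le u v).trans_lt (ENNReal.add_lt_top.2 ⟨hu', hv'⟩)⟩
    unfold IsHarmonicOnDisc
    rw [extendZero_add]
    exact HarmonicOnNhd.add hu hv
  smul_mem' := by
    rintro c u ⟨hu, hu'⟩
    refine ⟨?_, ?_⟩
    · unfold IsHarmonicOnDisc
      rw [extendZero_smul]
      exact HarmonicOnNhd.const_smul hu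
    · rw [hardyVariation_smul]
      exact ENNReal.mul_lt_top enorm_lt_top hu'

/-- The space `h^BV` of functions, with the seminorm `‖u‖_BV`. The normed space belonging to it is
its separation quotient, in which functions at distance zero are identified. -/
def HBV : Type := hbv

instance : AddCommGroup HBV := inferInstanceAs (AddCommGroup hbv)

instance : Module ℝ HBV := inferInstanceAs (Module ℝ hbv)

/-- The function underlying an element of `HBV`. -/
def HBV.toFun (u : HBV) : Disc → ℝ := Subtype.val (p := fun u => u ∈ hbv) u

/-- `‖u‖_BV`, as a real number, is a seminorm on `h^BV`. -/
def HBV.addGroupSeminorm : AddGroupSeminorm HBV where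
  toFun u := (hardyVariation u.toFun).toReal
  map_zero' := by
    change (hardyVariation 0).toReal = 0
    simp [hardyVariation_zero]
  add_le' u v := by
    have hu : hardyVariation u.toFun < ∞ := u.2.2
    have hv : hardyVariation v.toFun < ∞ := v.2.2
    rw [← ENNReal.toReal_add hu.ne hv.ne]
    exact ENNReal.toReal_mono (ENNReal.add_lt_top.2 ⟨hu, hv⟩).ne (hardyVariation_add_le _ _)
  neg' u := by
    change (hardyVariation (-u.toFun)).toReal = _
    rw [hardyVariation_neg]

instance : SeminormedAddCommGroup HBV := HBV.addGroupSeminorm.toSeminormedAddCommGroup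

instance : NormedSpace ℝ HBV where
  norm_smul_le c u := by
    change (hardyVariation (c • u.toFun)).toReal ≤ ‖c‖ * (hardyVariation u.toFun).toReal
    rw [hardyVariation_smul, ENNReal.toReal_mul, toReal_enorm]

/-! ### The Henstock–Kurzweil integral over a period -/

/-- The interval `[-π, π]`, as a one-dimensional box. -/
def periodBox : BoxIntegral.Box (Fin 1) where
  lower _ := -Real.pi
  upper _ := Real.pi
  lower_lt_upper _ := by linarith [Real.pi_pos]

/-- `f` is Henstock–Kurzweil integrable over `[-π, π]`. -/
def HKIntegrable (f : ℝ → ℝ) : Prop :=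
  BoxIntegral.Integrable periodBox BoxIntegral.IntegrationParams.Henstock
    (fun x : Fin 1 → ℝ => f (x 0)) (volume : Measure (Fin 1 → ℝ)).toBoxAdditive.toSMul

/-- The Henstock–Kurzweil integral of `f` over `[-π, π]`. -/
def hkIntegral (f : ℝ → ℝ) : ℝ :=
  BoxIntegral.integral periodBox BoxIntegral.IntegrationParams.Henstock
    (fun x : Fin 1 → ℝ => f (x 0)) (volume : Measure (Fin 1 → ℝ)).toBoxAdditive.toSMul

/-- The class `HK`: the `2π`-periodic functions that are Henstock–Kurzweil integrable over a
period. -/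
def IsHK (f : ℝ → ℝ) : Prop :=
  Function.Periodic f (2 * Real.pi) ∧ HKIntegrable f

end PoissonBV

end

noncomputable section

namespace PoissonBV

/-! ### Periodic functions of bounded variation -/

/-! Moving `θ` into `g` by substitution exhibits each slice of `P[g]` as an average of translates of
`g` against the probability density `Φ_r` (`slice_poissonIntegral`). Sup norm and variation over a
period are convex and translation invariant, which yields (b), (c), (d). As `Φ_r` concentrates at 0,
the slices converge to `g` at each point of continuity, that is, off a countable set.

For (a), a Henstock–Kurzweil integrable `f` has a continuous primitive, and summation by parts
bounds the Riemann sums of `f g` by the sup of that primitive times `V g + sup |g|`, up to an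
arbitrarily small error (`HKIntegrable.eventually_abs_integralSum_mul_le`). By Weierstrass, `f` is a
continuous `p` plus a remainder with uniformly small primitive. The remainder contributes little,
uniformly in `r`, because the slices are bounded in sup norm and variation; for `p`, dominated
convergence suffices.

For (e), slices are continuous, so subtracting one leaves every jump of the boundary function
intact.

For (f), the inequality opposite to (d) follows from convergence at continuity points, with right
continuity handling the remaining points. Surjectivity is a Helly argument: the functions `u_r -
u_r(0)` are uniformly bounded with bounded variation, so they converge pointwise along an
ultrafilter to some `g`, and passing to the limit in `u(r z) = P[u_r](z)` gives `u = P[g] + c`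
(`exists_isBV_eq_poissonIntegral_add`). A right continuous modification of `g` has the same Poisson
integral. Lower semicontinuity of the variation makes `NBV` complete, and the isometry transfers
this to the quotient of `h^BV`. -/

lemma eVariationOn_comp_add_const (g : ℝ → ℝ) (a b c : ℝ) :
    eVariationOn (fun x => g (x + c)) (Icc a b) = eVariationOn g (Icc (a + c) (b + c)) := by
  rw [← image_add_const_Icc]
  exact eVariationOn.comp_eq_of_monotoneOn g (fun x => x + c) fun x _ y _ h => by simpa using h

lemma eVariationOn_Icc_add_int_mul {g : ℝ → ℝ} {T : ℝ} (hg : Function.Periodic g T) (a b : ℝ)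
    (n : ℤ) : eVariationOn g (Icc (a + n * T) (b + n * T)) = eVariationOn g (Icc a b) := by
  rw [← eVariationOn_comp_add_const]
  congr 1
  funext x
  exact hg.int_mul n x

/-- An integer translation brings `a` into `[-π, π)`. Cutting `[a, a + 2π]` at `π` and `[-π, π]` at
`a` then gives the same two pieces, up to a shift of one of them by a period. -/
lemma eVariationOn_Icc_period {g : ℝ → ℝ} (hg : Function.Periodic g (2 * Real.pi)) (a : ℝ) :
    eVariationOn g (Icc a (a + 2 * Real.pi)) = variation g := by
  have hpi := Real.pi_pos
  wlog ha : a ∈ Ico (-Real.pi) Real.pi generalizing a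
  · obtain ⟨n, hn, -⟩ := existsUnique_add_zsmul_mem_Ico Real.two_pi_pos a (-Real.pi)
    rw [zsmul_eq_mul] at hn
    have h := this (a + n * (2 * Real.pi)) ⟨hn.1, by linarith [hn.2]⟩
    rw [← h, ← eVariationOn_Icc_add_int_mul hg a _ n]
    congr 2
    ring
  have h1 := eVariationOn.Icc_add_Icc g (s := univ) (a := a) (b := Real.pi)
    (c := a + 2 * Real.pi) ha.2.le (by linarith [ha.1]) (mem_univ _)
  have h2 := eVariationOn.Icc_add_Icc g (s := univ) (a := -Real.pi) (b := a)
    (c := Real.pi) ha.1 ha.2.le (mem_univ _)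
  simp only [univ_inter] at h1 h2
  have h3 := eVariationOn_Icc_add_int_mul hg (-Real.pi) a 1
  rw [show -Real.pi + ((1 : ℤ) : ℝ) * (2 * Real.pi) = Real.pi by push_cast; ring,
    show a + ((1 : ℤ) : ℝ) * (2 * Real.pi) = a + 2 * Real.pi by push_cast; ring] at h3
  rw [variation, ← h1, ← h2, h3, add_comm]

lemma variation_comp_add_const {g : ℝ → ℝ} (hg : Function.Periodic g (2 * Real.pi)) (c : ℝ) :
    variation (fun x => g (x + c)) = variation g := by
  rw [variation, eVariationOn_comp_add_const, ← eVariationOn_Icc_period hg (-Real.pi + c)]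
  congr 2
  ring

lemma edist_le_variation {g : ℝ → ℝ} (hg : Function.Periodic g (2 * Real.pi)) (x y : ℝ) :
    edist (g x) (g y) ≤ variation g := by
  obtain ⟨x', hx', hx⟩ := hg.exists_mem_Ico Real.two_pi_pos x (-Real.pi)
  obtain ⟨y', hy', hy⟩ := hg.exists_mem_Ico Real.two_pi_pos y (-Real.pi)
  rw [hx, hy]
  exact eVariationOn.edist_le g ⟨hx'.1, by linarith [hx'.2]⟩ ⟨hy'.1, by linarith [hy'.2]⟩

lemma IsBV.abs_sub_le {g : ℝ → ℝ} (hg : IsBV g) (x y : ℝ) :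
    |g x - g y| ≤ (variation g).toReal := by
  rw [← Real.dist_eq, dist_edist]
  exact ENNReal.toReal_mono hg.2.ne (edist_le_variation hg.1 x y)

lemma IsBV.eVariationOn_Icc_lt_top {g : ℝ → ℝ} (hg : IsBV g) (a b : ℝ) :
    eVariationOn g (Icc a b) < ∞ := by
  have hpi := Real.two_pi_pos
  have key : ∀ n : ℕ, eVariationOn g (Icc a (a + n * (2 * Real.pi))) < ∞ := by
    intro n
    induction n with
    | zero => simp
    | succ n ih =>
      have h1 := eVariationOn.Icc_add_Icc g (s := univ) (a := a) (b := a + n * (2 * Real.pi))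
        (c := a + n * (2 * Real.pi) + 2 * Real.pi) (by
          have : 0 ≤ (n : ℝ) * (2 * Real.pi) := by positivity
          linarith) (by linarith) (mem_univ _)
      simp only [univ_inter] at h1
      rw [show a + ((n + 1 : ℕ) : ℝ) * (2 * Real.pi)
        = a + n * (2 * Real.pi) + 2 * Real.pi by push_cast; ring, ← h1,
        eVariationOn_Icc_period hg.1]
      exact ENNReal.add_lt_top.2 ⟨ih, hg.2⟩
  obtain ⟨n, hn⟩ := exists_nat_ge ((b - a) / (2 * Real.pi))
  rw [div_le_iff₀ hpi] at hn
  exact (eVariationOn.mono g (Icc_subset_Icc_right (by linarith))).trans_lt (key n)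

lemma IsBV.locallyBoundedVariationOn {g : ℝ → ℝ} (hg : IsBV g) :
    LocallyBoundedVariationOn g univ := fun a b _ _ => by
  rw [univ_inter]
  exact (hg.eVariationOn_Icc_lt_top a b).ne

/-- The Jordan decomposition on the whole line is the source of measurability, integrability,
one-sided limits and the countability of the discontinuities. The monotone parts need not be
periodic. -/
lemma IsBV.exists_monotone_sub {g : ℝ → ℝ} (hg : IsBV g) :
    ∃ p q : ℝ → ℝ, Monotone p ∧ Monotone q ∧ g = p - q := by
  obtain ⟨p, q, hp, hq, h⟩ := hg.locallyBoundedVariationOn.exists_monotoneOn_sub_monotoneOn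
  exact ⟨p, q, monotoneOn_univ.1 hp, monotoneOn_univ.1 hq, h⟩

lemma IsBV.measurable {g : ℝ → ℝ} (hg : IsBV g) : Measurable g := by
  obtain ⟨p, q, hp, hq, rfl⟩ := hg.exists_monotone_sub
  exact hp.measurable.sub hq.measurable

lemma IsBV.countable_not_continuousAt {g : ℝ → ℝ} (hg : IsBV g) :
    {x | ¬ContinuousAt g x}.Countable := by
  obtain ⟨p, q, hp, hq, rfl⟩ := hg.exists_monotone_sub
  refine (hp.countable_not_continuousAt.union hq.countable_not_continuousAt).mono fun x hx => ?_
  by_contra h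
  simp only [mem_union, mem_ofPred_eq, not_or, not_not] at h
  exact hx (h.1.sub h.2)

lemma IsBV.abs_le {g : ℝ → ℝ} (hg : IsBV g) (x : ℝ) : |g x| ≤ |g 0| + (variation g).toReal := by
  have h := hg.abs_sub_le x 0
  have h2 := abs_sub_abs_le_abs_sub (g x) (g 0)
  linarith

/-! ### The Poisson kernel -/

lemma polarPoissonKernel_denom_pos {r : ℝ} (hr : r ∈ Ico (0 : ℝ) 1) (θ : ℝ) :
    0 < 1 - 2 * r * Real.cos θ + r ^ 2 := by
  nlinarith [mul_nonneg hr.1 (sub_nonneg.2 (Real.cos_le_one θ)), sq_pos_of_pos (sub_pos.2 hr.2)]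

lemma polarPoissonKernel_nonneg {r : ℝ} (hr : r ∈ Ico (0 : ℝ) 1) (θ : ℝ) :
    0 ≤ polarPoissonKernel r θ := by
  have h := polarPoissonKernel_denom_pos hr θ
  have h1 : 0 ≤ 1 - r ^ 2 := by nlinarith [hr.1, hr.2]
  unfold polarPoissonKernel
  have := Real.pi_pos
  positivity

lemma continuous_polarPoissonKernel {r : ℝ} (hr : r ∈ Ico (0 : ℝ) 1) :
    Continuous (polarPoissonKernel r) := by
  unfold polarPoissonKernel
  refine Continuous.div (by fun_prop) (by fun_prop) fun θ => ?_
  have h := polarPoissonKernel_denom_pos hr θ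
  have := Real.pi_pos
  positivity

lemma periodic_polarPoissonKernel (r : ℝ) :
    Function.Periodic (polarPoissonKernel r) (2 * Real.pi) := fun θ => by
  simp [polarPoissonKernel]

/-- The law of cosines for `|e^{iφ} - r e^{iθ}|²` identifies the real kernel with the complex one,
so that Poisson's formula for harmonic functions becomes available. -/
lemma polarPoissonKernel_sub_eq (r θ φ : ℝ) :
    polarPoissonKernel r (φ - θ) =
      (2 * Real.pi)⁻¹ * poissonKernel 0 (circleMap 0 r θ) (circleMap 0 1 φ) := by
  have h : ‖circleMap 0 1 φ - circleMap 0 r θ‖ ^ 2 = 1 - 2 * r * Real.cos (φ - θ) + r ^ 2 := by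
    have h1 : circleMap 0 1 φ - circleMap 0 r θ = ((Real.cos φ - r * Real.cos θ : ℝ) : ℂ)
        + ((Real.sin φ - r * Real.sin θ : ℝ) : ℂ) * Complex.I := by
      simp only [circleMap, Complex.exp_mul_I]
      push_cast
      ring
    rw [h1, Complex.norm_add_mul_I, Real.sq_sqrt (by positivity), Real.cos_sub]
    nlinarith [Real.sin_sq_add_cos_sq φ, Real.sin_sq_add_cos_sq θ]
  rw [poissonKernel_def, sub_zero, sub_zero, h, polarPoissonKernel, norm_circleMap_zero,
    norm_circleMap_zero]
  simp only [abs_one, sq_abs, one_pow]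
  rw [inv_mul_eq_div, div_div, mul_comm (2 * Real.pi)]

lemma circleMap_norm_arg (w : ℂ) : circleMap 0 ‖w‖ (Complex.arg w) = w := by
  simp [circleMap]

lemma intervalIntegral_period {f : ℝ → ℝ} (hf : Function.Periodic f (2 * Real.pi)) (a : ℝ) :
    ∫ x in a..a + 2 * Real.pi, f x = ∫ x in (-Real.pi)..Real.pi, f x := by
  rw [hf.intervalIntegral_add_eq a (-Real.pi)]
  congr 1
  ring

lemma integral_polarPoissonKernel {r : ℝ} (hr : r ∈ Ico (0 : ℝ) 1) :
    ∫ ψ in (-Real.pi)..Real.pi, polarPoissonKernel r ψ = 1 := by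
  have hw : circleMap 0 r 0 ∈ Metric.ball (0 : ℂ) 1 := by
    simpa [circleMap, abs_of_nonneg hr.1] using hr.2
  have h := HarmonicOnNhd.circleAverage_poissonKernel_smul (f := fun _ => (1 : ℝ))
    (harmonicOnNhd_const 1) hw
  rw [Real.circleAverage_def] at h
  rw [← intervalIntegral_period (periodic_polarPoissonKernel r) 0, zero_add, ← h,
    ← intervalIntegral.integral_smul]
  refine intervalIntegral.integral_congr fun φ _ => ?_
  have := polarPoissonKernel_sub_eq r 0 φ
  rw [sub_zero] at this
  simp [this]

/-! ### Slices of Poisson integrals -/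

lemma circleMap_mem_ball {r : ℝ} (hr : r ∈ Ico (0 : ℝ) 1) (θ : ℝ) :
    circleMap 0 r θ ∈ Metric.ball (0 : ℂ) 1 := by
  simpa [abs_of_nonneg hr.1] using hr.2

lemma slice_eq {r : ℝ} (hr : r ∈ Ico (0 : ℝ) 1) (u : Disc → ℝ) (θ : ℝ) :
    slice u r θ = u ⟨circleMap 0 r θ, circleMap_mem_ball hr θ⟩ :=
  dif_pos (circleMap_mem_ball hr θ)

lemma periodic_slice (u : Disc → ℝ) (r : ℝ) : Function.Periodic (slice u r) (2 * Real.pi) :=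
  fun θ => by simp only [slice, periodic_circleMap 0 r θ]

lemma poissonIntegral_eq {g : ℝ → ℝ} (hg : Function.Periodic g (2 * Real.pi)) (w : Disc) :
    poissonIntegral g w = Real.circleAverage
      (poissonKernel 0 (w : ℂ) • fun z => g (Complex.arg z)) 0 1 := by
  have hF : Function.Periodic (fun φ => g φ * polarPoissonKernel ‖(w : ℂ)‖
      (φ - Complex.arg (w : ℂ))) (2 * Real.pi) := fun φ => by
    have h := periodic_polarPoissonKernel ‖(w : ℂ)‖ (φ - Complex.arg (w : ℂ))
    rw [show φ - Complex.arg (w : ℂ) + 2 * Real.pi = φ + 2 * Real.pi - Complex.arg (w : ℂ) by ring]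
      at h
    simp only [hg φ, h]
  rw [Real.circleAverage_def, poissonIntegral, ← intervalIntegral_period hF 0, zero_add,
    ← intervalIntegral.integral_smul]
  refine intervalIntegral.integral_congr fun φ _ => ?_
  have harg : g (Complex.arg (circleMap 0 1 φ)) = g φ := by
    have h1 : circleMap 0 1 φ = Complex.exp (φ * Complex.I) := by simp [circleMap]
    rw [h1, Complex.arg_exp_mul_I]
    have h2 := toIocMod_add_toIocDiv_zsmul Real.two_pi_pos (-Real.pi) φ
    conv_rhs => rw [← h2]
    exact (hg.zsmul _ _).symm
  simp only [polarPoissonKernel_sub_eq, circleMap_norm_arg, Pi.smul_apply', harg, smul_eq_mul]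
  ring

/-- Here the kernel no longer depends on `θ`: the slice is an average of translates of `g`, the form
from which the norm and variation estimates are read off. -/
lemma slice_poissonIntegral {g : ℝ → ℝ} (hg : Function.Periodic g (2 * Real.pi)) {r : ℝ}
    (hr : r ∈ Ico (0 : ℝ) 1) (θ : ℝ) :
    slice (poissonIntegral g) r θ =
      ∫ ψ in (-Real.pi)..Real.pi, g (ψ + θ) * polarPoissonKernel r ψ := by
  have hF : Function.Periodic (fun φ => g φ * polarPoissonKernel r (φ - θ)) (2 * Real.pi) :=
    fun φ => by
      have h := periodic_polarPoissonKernel r (φ - θ)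
      rw [show φ - θ + 2 * Real.pi = φ + 2 * Real.pi - θ by ring] at h
      simp only [hg φ, h]
  have h1 : slice (poissonIntegral g) r θ
      = ∫ φ in (-Real.pi)..Real.pi, g φ * polarPoissonKernel r (φ - θ) := by
    rw [slice_eq hr, poissonIntegral]
    refine intervalIntegral.integral_congr fun φ _ => ?_
    simp only [polarPoissonKernel_sub_eq, circleMap_norm_arg]
  have h2 := intervalIntegral.integral_comp_add_right (a := -Real.pi) (b := Real.pi)
    (fun φ => g φ * polarPoissonKernel r (φ - θ)) θ
  simp only [add_sub_cancel_right] at h2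
  rw [h1, h2, ← intervalIntegral_period hF (-Real.pi + θ)]
  congr 1
  ring

lemma integrable_mul_polarPoissonKernel {g : ℝ → ℝ} (hg : IsBV g) {r : ℝ}
    (hr : r ∈ Ico (0 : ℝ) 1) (θ : ℝ) (a b : ℝ) :
    IntervalIntegrable (fun ψ => g (ψ + θ) * polarPoissonKernel r ψ) volume a b := by
  refine IntervalIntegrable.mul_continuousOn ?_ (continuous_polarPoissonKernel hr).continuousOn
  obtain ⟨p, q, hp, hq, rfl⟩ := hg.exists_monotone_sub
  have hp' : Monotone fun ψ => p (ψ + θ) := fun x y h => hp (by linarith)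
  have hq' : Monotone fun ψ => q (ψ + θ) := fun x y h => hq (by linarith)
  exact hp'.intervalIntegrable.sub hq'.intervalIntegrable

lemma abs_integral_mul_polarPoissonKernel_le {h : ℝ → ℝ} {C : ℝ} (hC : ∀ ψ, |h ψ| ≤ C) {r : ℝ}
    (hr : r ∈ Ico (0 : ℝ) 1) :
    |∫ ψ in (-Real.pi)..Real.pi, h ψ * polarPoissonKernel r ψ| ≤ C := by
  have hpi := Real.pi_pos
  have h1 := intervalIntegral.norm_integral_le_of_norm_le (μ := volume)
    (f := fun ψ => h ψ * polarPoissonKernel r ψ)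
    (g := fun ψ => C * polarPoissonKernel r ψ) (a := -Real.pi) (b := Real.pi) (by linarith)
    (Eventually.of_forall fun ψ _ => by
      rw [norm_mul, Real.norm_eq_abs, Real.norm_of_nonneg (polarPoissonKernel_nonneg hr ψ)]
      exact mul_le_mul_of_nonneg_right (hC ψ) (polarPoissonKernel_nonneg hr ψ))
    (((continuous_polarPoissonKernel hr).intervalIntegrable _ _).const_mul C)
  rwa [intervalIntegral.integral_const_mul, integral_polarPoissonKernel hr, mul_one] at h1

lemma abs_slice_poissonIntegral_le {g : ℝ → ℝ} (hg : IsBV g) {C : ℝ} (hC : ∀ x, |g x| ≤ C)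
    {r : ℝ} (hr : r ∈ Ico (0 : ℝ) 1) (θ : ℝ) : |slice (poissonIntegral g) r θ| ≤ C := by
  rw [slice_poissonIntegral hg.1 hr]
  exact abs_integral_mul_polarPoissonKernel_le (fun ψ => hC _) hr

lemma iSup_enorm_slice_poissonIntegral_le {g : ℝ → ℝ} (hg : IsBV g) {r : ℝ}
    (hr : r ∈ Ico (0 : ℝ) 1) :
    (⨆ θ : ℝ, ‖slice (poissonIntegral g) r θ‖ₑ) ≤ (⨅ θ : ℝ, ‖g θ‖ₑ) + variation g := by
  rw [ENNReal.iInf_add]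
  refine iSup_le fun θ => le_iInf fun y => ?_
  have h := abs_slice_poissonIntegral_le hg (C := |g y| + (variation g).toReal) (fun x => by
    have h1 := hg.abs_sub_le x y
    have h2 := abs_sub_abs_le_abs_sub (g x) (g y)
    linarith) hr θ
  rw [← ENNReal.ofReal_toReal hg.2.ne, Real.enorm_eq_ofReal_abs, Real.enorm_eq_ofReal_abs,
    ← ENNReal.ofReal_add (abs_nonneg _) ENNReal.toReal_nonneg]
  exact ENNReal.ofReal_le_ofReal h

/-- For a fixed partition, the sum of the increments of the slice is at most the average over `ψ` of
the corresponding sums for `g(ψ + ·)`, and each of those is at most `V g` by periodicity. -/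
lemma variation_slice_poissonIntegral_le {g : ℝ → ℝ} (hg : IsBV g) {r : ℝ}
    (hr : r ∈ Ico (0 : ℝ) 1) : variation (slice (poissonIntegral g) r) ≤ variation g := by
  have hpi := Real.pi_pos
  refine iSup_le fun p => ?_
  obtain ⟨n, u, hu, hus⟩ := p
  simp only
  set v := slice (poissonIntegral g) r with hv
  have hsum : ∀ f : ℝ → ℝ, ∑ i ∈ Finset.range n, edist (f (u (i + 1))) (f (u i))
      = ENNReal.ofReal (∑ i ∈ Finset.range n, |f (u (i + 1)) - f (u i)|) := fun f => by
    rw [ENNReal.ofReal_sum_of_nonneg fun i _ => abs_nonneg _]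
    exact Finset.sum_congr rfl fun i _ => by rw [edist_dist, Real.dist_eq]
  rw [hsum, ENNReal.ofReal_le_iff_le_toReal hg.2.ne]
  have hdiff : ∀ i, |v (u (i + 1)) - v (u i)| ≤ ∫ ψ in (-Real.pi)..Real.pi,
      |g (ψ + u (i + 1)) - g (ψ + u i)| * polarPoissonKernel r ψ := fun i => by
    rw [hv, slice_poissonIntegral hg.1 hr, slice_poissonIntegral hg.1 hr,
      ← intervalIntegral.integral_sub (integrable_mul_polarPoissonKernel hg hr _ _ _)
        (integrable_mul_polarPoissonKernel hg hr _ _ _)]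
    refine (intervalIntegral.abs_integral_le_integral_abs (by linarith)).trans_eq ?_
    refine intervalIntegral.integral_congr fun ψ _ => ?_
    rw [← sub_mul, abs_mul, abs_of_nonneg (polarPoissonKernel_nonneg hr ψ)]
  have hint : ∀ i, IntervalIntegrable (fun ψ => |g (ψ + u (i + 1)) - g (ψ + u i)|
      * polarPoissonKernel r ψ) volume (-Real.pi) Real.pi := fun i => by
    refine (((integrable_mul_polarPoissonKernel hg hr (u (i + 1)) _ _).sub
      (integrable_mul_polarPoissonKernel hg hr (u i) _ _)).abs).congr fun ψ _ => ?_
    rw [← sub_mul, abs_mul, abs_of_nonneg (polarPoissonKernel_nonneg hr ψ)]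
  refine (Finset.sum_le_sum fun i _ => hdiff i).trans ?_
  rw [← intervalIntegral.integral_finsetSum fun i _ => hint i]
  simp only [← Finset.sum_mul]
  refine (le_abs_self _).trans (abs_integral_mul_polarPoissonKernel_le
    (h := fun ψ => ∑ i ∈ Finset.range n, |g (ψ + u (i + 1)) - g (ψ + u i)|) (fun ψ => ?_) hr)
  rw [abs_of_nonneg (Finset.sum_nonneg fun i _ => abs_nonneg _),
    ← ENNReal.ofReal_le_iff_le_toReal hg.2.ne, ← variation_comp_add_const hg.1 ψ]
  have h := hsum (fun x => g (x + ψ))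
  simp only [add_comm _ ψ] at h
  simp only [add_comm _ ψ, ← h]
  exact eVariationOn.sum_le (f := fun x => g (ψ + x)) hu hus

/-! ### Boundary behaviour -/

lemma tendstoUniformlyOn_polarPoissonKernel {U : Set ℝ} (hU : IsOpen U) (h0 : (0 : ℝ) ∈ U) :
    TendstoUniformlyOn polarPoissonKernel 0 (𝓝[<] 1) (Ioc (-Real.pi) Real.pi \ U) := by
  have hpi := Real.pi_pos
  obtain ⟨δ, hδ, hδU⟩ := Metric.isOpen_iff.1 hU 0 h0
  set d := min δ Real.pi
  have hd : 0 < d := lt_min hδ hpi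
  have hc : 0 < 1 - Real.cos d := by
    have := Real.cos_lt_cos_of_nonneg_of_le_pi le_rfl (min_le_right δ Real.pi) hd
    rw [Real.cos_zero] at this
    linarith
  have hlim : Tendsto (fun r : ℝ => (1 - r ^ 2) / (2 * Real.pi * (1 - Real.cos d))) (𝓝[<] 1)
      (𝓝 0) := by
    have : Tendsto (fun r : ℝ => (1 - r ^ 2) / (2 * Real.pi * (1 - Real.cos d))) (𝓝 1)
        (𝓝 ((1 - 1 ^ 2) / (2 * Real.pi * (1 - Real.cos d)))) :=
      Continuous.tendsto (by fun_prop) 1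
    simpa using this.mono_left nhdsWithin_le_nhds
  rw [Metric.tendstoUniformlyOn_iff]
  intro ε hε
  filter_upwards [hlim.eventually_lt_const hε, Ioo_mem_nhdsLT (show (1 / 2 : ℝ) < 1 by norm_num)]
    with r hr1 hr2 ψ hψ
  have hr : r ∈ Ico (0 : ℝ) 1 := ⟨by linarith [hr2.1], hr2.2⟩
  rw [Pi.zero_apply, dist_comm, Real.dist_0_eq_abs, abs_of_nonneg (polarPoissonKernel_nonneg hr ψ)]
  refine lt_of_le_of_lt ?_ hr1
  have hψd : Real.cos ψ ≤ Real.cos d := by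
    rw [← Real.cos_abs ψ]
    refine Real.cos_le_cos_of_nonneg_of_le_pi hd.le (abs_le.2 ⟨hψ.1.1.le, hψ.1.2⟩) ?_
    by_contra hlt
    refine hψ.2 (hδU ?_)
    rw [Metric.mem_ball, Real.dist_0_eq_abs]
    exact (not_le.1 hlt).trans_le (min_le_left _ _)
  unfold polarPoissonKernel
  refine div_le_div_of_nonneg_left (by nlinarith [hr.1, hr.2]) (by positivity) ?_
  refine mul_le_mul_of_nonneg_left ?_ (by positivity)
  -- `1 - 2r cos d + r² = (1 - r)² + 2r(1 - cos d)`, and `2r ≥ 1`; this is why `r` was restricted to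
  -- `r > 1/2`.
  nlinarith [sq_nonneg (1 - r), hr2.1]

lemma tendsto_slice_poissonIntegral {g : ℝ → ℝ} (hg : IsBV g) {θ : ℝ} (hθ : ContinuousAt g θ) :
    Tendsto (fun r => slice (poissonIntegral g) r θ) (𝓝[<] 1) (𝓝 (g θ)) := by
  have hpi := Real.pi_pos
  have hev : ∀ᶠ r in 𝓝[<] (1 : ℝ), r ∈ Ico (0 : ℝ) 1 := by
    filter_upwards [Ioo_mem_nhdsLT (show (0 : ℝ) < 1 by norm_num)] with r hr using ⟨hr.1.le, hr.2⟩
  have h := tendsto_setIntegral_peak_smul_of_integrableOn_of_tendsto (μ := volume)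
    (s := Ioc (-Real.pi) Real.pi) (t := Ioc (-Real.pi) Real.pi) (x₀ := (0 : ℝ)) (l := 𝓝[<] (1 : ℝ))
    (φ := polarPoissonKernel) (g := fun ψ => g (ψ + θ)) (a := g θ)
    measurableSet_Ioc measurableSet_Ioc subset_rfl self_mem_nhdsWithin (by simp)
    (hev.mono fun r hr ψ _ => polarPoissonKernel_nonneg hr ψ)
    (fun U hU h0 => tendstoUniformlyOn_polarPoissonKernel hU h0)
    (tendsto_const_nhds.congr' (hev.mono fun r hr => by
      beta_reduce
      rw [← intervalIntegral.integral_of_le (by linarith), integral_polarPoissonKernel hr]))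
    (hev.mono fun r hr => (continuous_polarPoissonKernel hr).aestronglyMeasurable)
    (by
      obtain ⟨p, q, hp, hq, rfl⟩ := hg.exists_monotone_sub
      have hp' : Monotone fun ψ => p (ψ + θ) := fun x y h => hp (by linarith)
      have hq' : Monotone fun ψ => q (ψ + θ) := fun x y h => hq (by linarith)
      exact (intervalIntegrable_iff_integrableOn_Ioc_of_le (by linarith)).1
        (hp'.intervalIntegrable.sub hq'.intervalIntegrable))
    (by
      have : Tendsto (fun ψ => ψ + θ) (𝓝[Ioc (-Real.pi) Real.pi] 0) (𝓝 θ) := by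
        have : Tendsto (fun ψ : ℝ => ψ + θ) (𝓝 0) (𝓝 (0 + θ)) :=
          Continuous.tendsto (by fun_prop) 0
        rw [zero_add] at this
        exact this.mono_left nhdsWithin_le_nhds
      exact hθ.tendsto.comp this)
  refine h.congr' (hev.mono fun r hr => ?_)
  beta_reduce
  rw [slice_poissonIntegral hg.1 hr, intervalIntegral.integral_of_le (by linarith)]
  simp only [smul_eq_mul, mul_comm]

/-! ### Harmonicity -/

lemma circleIntegrable_comp_arg {g : ℝ → ℝ} (hg : IsBV g) :
    CircleIntegrable (fun z => g (Complex.arg z)) 0 1 := by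
  unfold CircleIntegrable
  refine IntervalIntegrable.mono_fun' (g := fun _ => |g 0| + (variation g).toReal)
    intervalIntegrable_const ?_ (Eventually.of_forall fun x => hg.abs_le _)
  exact (hg.measurable.comp (Complex.measurable_arg.comp
    (continuous_circleMap 0 1).measurable)).aestronglyMeasurable

/-- The Poisson kernel is the real part of the Herglotz–Riesz kernel, so the Poisson integral is
locally the real part of an analytic function. -/
lemma isHarmonicOnDisc_poissonIntegral {g : ℝ → ℝ} (hg : IsBV g) :
    IsHarmonicOnDisc (poissonIntegral g) := by
  have hci := circleIntegrable_comp_arg hg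
  have hci' : CircleIntegrable (fun z => (g (Complex.arg z) : ℂ)) 0 1 := by
    simp only [CircleIntegrable, intervalIntegrable_iff] at hci ⊢
    exact Complex.ofRealCLM.integrable_comp hci
  intro w hw
  have han := analyticOnNhd_circleAverage_herglotzRieszKernel_smul hci' w hw
  refine (harmonicAt_congr_nhds ?_).2 han.harmonicAt_re
  filter_upwards [Metric.isOpen_ball.mem_nhds hw] with z hz
  rw [re_circleAverage_herglotzRieszKernel_smul hci hz, ← poissonKernel_eq_re_herglotzRieszKernel]
  exact (dif_pos hz).trans (poissonIntegral_eq hg.1 ⟨z, hz⟩)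

/-- Poisson's formula holds on the disc of radius `ρ < 1`, whose closure lies in `D`; scaling both
arguments of the kernel by `ρ` does not change it. -/
lemma IsHarmonicOnDisc.extendZero_eq {u : Disc → ℝ} (hu : IsHarmonicOnDisc u) {ρ : ℝ}
    (hρ : ρ ∈ Ioo (0 : ℝ) 1) (z : Disc) :
    extendZero u (ρ * z) = poissonIntegral (slice u ρ) z := by
  have hz : (ρ : ℂ) * (z : ℂ) ∈ Metric.ball (0 : ℂ) ρ := by
    have := z.2
    rw [mem_ball_zero_iff] at this ⊢
    rw [norm_mul, Complex.norm_real, Real.norm_of_nonneg hρ.1.le]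
    nlinarith [hρ.1]
  have h := HarmonicOnNhd.circleAverage_poissonKernel_smul
    (HarmonicOnNhd.mono hu (Metric.closedBall_subset_ball hρ.2)) hz
  rw [← h, poissonIntegral_eq (periodic_slice u ρ), Real.circleAverage_def, Real.circleAverage_def]
  congr 1
  refine intervalIntegral.integral_congr fun φ _ => ?_
  have hcm : circleMap 0 ρ φ = ρ * circleMap 0 1 φ := by simp [circleMap]
  have harg : slice u ρ (Complex.arg (circleMap 0 1 φ)) = extendZero u (circleMap 0 ρ φ) := by
    have h1 := circleMap_norm_arg (circleMap 0 1 φ)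
    rw [norm_circleMap_zero, abs_one] at h1
    have h2 : circleMap 0 ρ (Complex.arg (circleMap 0 1 φ)) = ρ * circleMap 0 1 φ := by
      conv_rhs => rw [← h1]
      simp [circleMap]
    rw [slice, h2, hcm]
  simp only [Pi.smul_apply', harg]
  congr 1
  rw [poissonKernel_def, poissonKernel_def, hcm]
  have hρ0 := hρ.1.ne'
  simp only [sub_zero, ← mul_sub, norm_mul, Complex.norm_real, Real.norm_of_nonneg hρ.1.le, mul_pow]
  rw [mul_div_mul_left _ _ (pow_ne_zero 2 hρ0)]

section HenstockKurzweil

/-! ### An Abel summation estimate for tagged partitions -/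

lemma toReal_eVariationOn_add {g : ℝ → ℝ} {a b c : ℝ} (hab : a ≤ b) (hbc : b ≤ c)
    (hg : eVariationOn g (Icc a c) ≠ ∞) :
    (eVariationOn g (Icc a b)).toReal + (eVariationOn g (Icc b c)).toReal
      = (eVariationOn g (Icc a c)).toReal := by
  have h := eVariationOn.Icc_add_Icc g (s := univ) hab hbc (mem_univ _)
  simp only [univ_inter] at h
  rw [← h] at hg ⊢
  rw [ENNReal.add_ne_top] at hg
  rw [ENNReal.toReal_add hg.1 hg.2]

lemma abs_sub_le_toReal_eVariationOn {g : ℝ → ℝ} {a b : ℝ} (hab : a ≤ b)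
    (hg : eVariationOn g (Icc a b) ≠ ∞) :
    |g a - g b| ≤ (eVariationOn g (Icc a b)).toReal := by
  rw [← Real.dist_eq]
  exact BoundedVariationOn.dist_le hg (left_mem_Icc.2 hab) (right_mem_Icc.2 hab)

/-- Summation by parts along a tagged partition of `(a, x]` into the intervals `(l i, u i]`. -/
lemma abs_sum_mul_sub_sub_le {ι : Type*} {l t u : ι → ℝ} {F g : ℝ → ℝ} {a η : ℝ} (hFa : F a = 0)
    (S : Finset ι) {x : ℝ} (hax : a ≤ x) (hF : ∀ y ∈ Icc a x, |F y| ≤ η)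
    (hlu : ∀ i ∈ S, l i < u i) (ht : ∀ i ∈ S, t i ∈ Icc (l i) (u i))
    (hdisj : ∀ i ∈ S, ∀ j ∈ S, i ≠ j → Disjoint (Ioc (l i) (u i)) (Ioc (l j) (u j)))
    (hU : ∀ y, (∃ i ∈ S, y ∈ Ioc (l i) (u i)) ↔ y ∈ Ioc a x)
    (hg : eVariationOn g (Icc a x) ≠ ∞) :
    |∑ i ∈ S, g (t i) * (F (u i) - F (l i)) - g x * F x|
      ≤ η * (eVariationOn g (Icc a x)).toReal := by
  classical
  induction hn : S.card generalizing S x with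
  | zero =>
    rw [Finset.card_eq_zero] at hn
    subst hn
    have hxa : x = a := by
      by_contra hne
      obtain ⟨i, hi, -⟩ := (hU x).2 ⟨lt_of_le_of_ne hax (Ne.symm hne), le_rfl⟩
      exact absurd hi (Finset.notMem_empty i)
    subst hxa
    simp [hFa]
  | succ n ih =>
    obtain ⟨j, hj⟩ : S.Nonempty := Finset.card_pos.1 (by omega)
    have hjx := (hU (u j)).1 ⟨j, hj, hlu j hj, le_rfl⟩
    -- Peel off the interval containing `x`, which is the rightmost one; the others partition `(a, l
    -- i]`.
    obtain ⟨i, hi, hix⟩ := (hU x).2 ⟨hjx.1.trans_le hjx.2, le_rfl⟩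
    have hux : u i = x := le_antisymm ((hU (u i)).1 ⟨i, hi, hlu i hi, le_rfl⟩).2 hix.2
    have hal : a ≤ l i := by
      by_contra hla
      exact absurd ((hU a).1 ⟨i, hi, not_le.1 hla, hax.trans hix.2⟩).1 (lt_irrefl _)
    have hti := ht i hi
    rw [hux] at hti
    have hlx : l i ≤ x := hix.1.le
    have hV1 : eVariationOn g (Icc a (l i)) ≠ ∞ :=
      ((eVariationOn.mono g (Icc_subset_Icc_right hlx)).trans_lt hg.lt_top).ne
    have hV2 : eVariationOn g (Icc (l i) x) ≠ ∞ :=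
      ((eVariationOn.mono g (Icc_subset_Icc_left hal)).trans_lt hg.lt_top).ne
    have hV3 : eVariationOn g (Icc (l i) (t i)) ≠ ∞ :=
      ((eVariationOn.mono g (Icc_subset_Icc_right hti.2)).trans_lt hV2.lt_top).ne
    have hV4 : eVariationOn g (Icc (t i) x) ≠ ∞ :=
      ((eVariationOn.mono g (Icc_subset_Icc_left hti.1)).trans_lt hV2.lt_top).ne
    have key := ih (S.erase i) hal (fun y hy => hF y ⟨hy.1, hy.2.trans hlx⟩)
      (fun j hj => hlu j (Finset.mem_of_mem_erase hj))
      (fun j hj => ht j (Finset.mem_of_mem_erase hj))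
      (fun j hj k hk => hdisj j (Finset.mem_of_mem_erase hj) k (Finset.mem_of_mem_erase hk))
      (fun y => by
        constructor
        · rintro ⟨j, hj, hjy⟩
          have h1 := (hU y).1 ⟨j, Finset.mem_of_mem_erase hj, hjy⟩
          refine ⟨h1.1, not_lt.1 fun hly => ?_⟩
          exact Set.disjoint_left.1 (hdisj j (Finset.mem_of_mem_erase hj) i hi
            (Finset.ne_of_mem_erase hj)) hjy ⟨hly, by rw [hux]; exact h1.2⟩
        · intro hy
          obtain ⟨j, hj, hjy⟩ := (hU y).2 ⟨hy.1, hy.2.trans hlx⟩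
          refine ⟨j, Finset.mem_erase.2 ⟨?_, hj⟩, hjy⟩
          rintro rfl
          exact absurd hjy.1 (not_lt.2 hy.2))
      hV1 (by rw [Finset.card_erase_of_mem hi, hn]; rfl)
    have hsum := Finset.add_sum_erase S (fun i => g (t i) * (F (u i) - F (l i))) hi
    have hη : 0 ≤ η := (abs_nonneg _).trans (hF a ⟨le_rfl, hax⟩)
    have e1 : |(g (l i) - g (t i)) * F (l i)|
        ≤ (eVariationOn g (Icc (l i) (t i))).toReal * η := by
      rw [abs_mul]
      exact mul_le_mul (abs_sub_le_toReal_eVariationOn hti.1 hV3) (hF _ ⟨hal, hlx⟩)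
        (abs_nonneg _) ENNReal.toReal_nonneg
    have e2 : |(g (t i) - g x) * F x| ≤ (eVariationOn g (Icc (t i) x)).toReal * η := by
      rw [abs_mul]
      exact mul_le_mul (abs_sub_le_toReal_eVariationOn hti.2 hV4) (hF _ ⟨hax, le_rfl⟩)
        (abs_nonneg _) ENNReal.toReal_nonneg
    rw [← toReal_eVariationOn_add hal hlx hg, ← toReal_eVariationOn_add hti.1 hti.2 hV2, ← hsum]
    simp only [hux]
    -- The boundary term moves from `x` to `l i`. The two corrections are increments of `g` over `[l
    -- i, t i]` and `[t i, x]`, each multiplied by a value of `F`, and their variations add up to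
    -- that over `[l i, x]`.
    calc |g (t i) * (F x - F (l i)) + ∑ i ∈ S.erase i, g (t i) * (F (u i) - F (l i)) - g x * F x|
        = |(∑ i ∈ S.erase i, g (t i) * (F (u i) - F (l i)) - g (l i) * F (l i))
            + (g (l i) - g (t i)) * F (l i) + (g (t i) - g x) * F x| := by
          congr 1
          ring
      _ ≤ _ := (abs_add_three _ _ _).trans (by linarith)

/-! ### The Henstock–Kurzweil integral in dimension one -/

open BoxIntegral

/-- The integration data of `HKIntegrable`: Lebesgue measure as a box-additive function. -/
abbrev hkVol : Fin 1 →ᵇᵃ ℝ →L[ℝ] ℝ := (volume : Measure (Fin 1 → ℝ)).toBoxAdditive.toSMul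

lemma hkVol_apply (J : Box (Fin 1)) (y : ℝ) : hkVol J y = (J.upper 0 - J.lower 0) * y := by
  simp [hkVol, Measure.toBoxAdditive, BoxAdditiveMap.toSMul_apply, measureReal_def,
    Box.coe_eq_pi, Real.volume_pi_Ioc_toReal, J.lower_le_upper]

/-- The half-open interval `(a, b]` as a one-dimensional box. -/
def intervalBox (a b : ℝ) (h : a < b) : Box (Fin 1) where
  lower _ := a
  upper _ := b
  lower_lt_upper _ := h

lemma eq_intervalBox (J : Box (Fin 1)) :
    J = intervalBox (J.lower 0) (J.upper 0) (J.lower_lt_upper 0) := by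
  obtain ⟨l, u, h⟩ := J
  simp only [intervalBox, Box.mk.injEq]
  constructor <;> funext i <;> rw [Subsingleton.elim i 0]

lemma mem_Icc_box {J : Box (Fin 1)} {x : Fin 1 → ℝ} :
    x ∈ Box.Icc J ↔ x 0 ∈ Icc (J.lower 0) (J.upper 0) := by
  rw [Box.Icc_def, mem_Icc, mem_Icc, Pi.le_def, Pi.le_def]
  simp

lemma mem_box {J : Box (Fin 1)} {x : Fin 1 → ℝ} :
    x ∈ J ↔ x 0 ∈ Ioc (J.lower 0) (J.upper 0) := by
  rw [Box.mem_def]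
  simp

lemma box_le_iff {J K : Box (Fin 1)} :
    J ≤ K ↔ K.lower 0 ≤ J.lower 0 ∧ J.upper 0 ≤ K.upper 0 := by
  rw [Box.le_iff_bounds, Pi.le_def, Pi.le_def]
  simp

open Classical in
/-- The indefinite Henstock–Kurzweil integral `x ↦ ∫_{-π}^x f`. -/
def hkPrimitive (f : ℝ → ℝ) (x : ℝ) : ℝ :=
  if h : -Real.pi < x then
    BoxIntegral.integral (intervalBox (-Real.pi) x h) IntegrationParams.Henstock
      (fun x : Fin 1 → ℝ => f (x 0)) hkVol
  else 0

lemma hkPrimitive_neg_pi (f : ℝ → ℝ) : hkPrimitive f (-Real.pi) = 0 := dif_neg (lt_irrefl _)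

lemma intervalBox_le_periodBox {a b : ℝ} (h : a < b) (ha : -Real.pi ≤ a) (hb : b ≤ Real.pi) :
    intervalBox a b h ≤ periodBox := box_le_iff.2 ⟨ha, hb⟩

lemma HKIntegrable.integral_eq {f : ℝ → ℝ} (hf : HKIntegrable f) {J : Box (Fin 1)}
    (hJ : J ≤ periodBox) :
    BoxIntegral.integral J IntegrationParams.Henstock (fun x : Fin 1 → ℝ => f (x 0)) hkVol
      = hkPrimitive f (J.upper 0) - hkPrimitive f (J.lower 0) := by
  have hJ' := box_le_iff.1 hJ
  have hlu := J.lower_lt_upper 0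
  have hlow : -Real.pi ≤ J.lower 0 := hJ'.1
  rcases hlow.eq_or_lt with h | h
  · rw [← h, hkPrimitive_neg_pi, sub_zero, hkPrimitive, dif_pos (h ▸ hlu)]
    congr 1
    conv_lhs => rw [eq_intervalBox J]
    simp only [h]
  · have hu : -Real.pi < J.upper 0 := h.trans hlu
    have hle : intervalBox (-Real.pi) (J.upper 0) hu ≤ periodBox :=
      intervalBox_le_periodBox hu le_rfl hJ'.2
    have hadd := (BoxIntegral.Integrable.toBoxAdditive hf).map_split_add
      (WithTop.coe_le_coe.2 hle) 0 (J.lower 0)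
    have hx : J.lower 0 ∈ Ioo ((intervalBox (-Real.pi) (J.upper 0) hu).lower 0)
        ((intervalBox (-Real.pi) (J.upper 0) hu).upper 0) := ⟨h, hlu⟩
    rw [Box.splitLower_def hx, Box.splitUpper_def hx] at hadd
    have e1 : ∀ (l u : Fin 1 → ℝ) (h' : ∀ i, l i < u i), (Box.mk l u h') =
        intervalBox (l 0) (u 0) (h' 0) := fun l u h' => eq_intervalBox _
    rw [e1, e1] at hadd
    simp only [Function.update_self, intervalBox] at hadd
    rw [hkPrimitive, hkPrimitive, dif_pos h, dif_pos hu, eq_sub_iff_add_eq']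
    exact (congrArg (fun K => _ + BoxIntegral.integral K IntegrationParams.Henstock
      (fun x : Fin 1 → ℝ => f (x 0)) hkVol) (eq_intervalBox J)).trans hadd

/-- The Saks–Henstock lemma, applied to the single interval between `x` and `t` tagged at `t`. The
gauge at `t` serves as `δ`; continuity of the primitive follows. -/
lemma HKIntegrable.abs_sub_le {f : ℝ → ℝ} (hf : HKIntegrable f) {ε : ℝ} (hε : 0 < ε) {t : ℝ}
    (ht : t ∈ Icc (-Real.pi) Real.pi) :
    ∃ δ > 0, ∀ x ∈ Icc (-Real.pi) Real.pi, |x - t| ≤ δ →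
      |hkPrimitive f x - hkPrimitive f t| ≤ ε + |f t| * |x - t| := by
  -- Henstock partitions carry no distortion condition, so the distortion constant may be 0.
  set r := BoxIntegral.Integrable.convergenceR hf ε 0 with hr
  refine ⟨r (fun _ => t), (r (fun _ => t)).2, fun x hx hxt => ?_⟩
  rcases eq_or_ne x t with rfl | hne
  · simpa using hε.le
  have hlt : min x t < max x t := by simpa using hne.symm
  have hle : intervalBox (min x t) (max x t) hlt ≤ periodBox :=
    intervalBox_le_periodBox hlt (le_min hx.1 ht.1) (max_le hx.2 ht.2)
  have htI : (fun _ => t : Fin 1 → ℝ) ∈ Box.Icc periodBox := mem_Icc_box.2 ht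
  set π := TaggedPrepartition.single periodBox _ hle (fun _ => t) htI with hπ
  have hmem : IntegrationParams.Henstock.MemBaseSet periodBox 0 r π := by
    refine ⟨?_, fun _ => ?_, fun h => by simp [IntegrationParams.Henstock] at h,
      fun h => by simp [IntegrationParams.Henstock] at h⟩
    · rw [hπ, TaggedPrepartition.isSubordinate_single]
      intro y hy
      have hy0 : y 0 ∈ Icc (min x t) (max x t) := mem_Icc_box.1 hy
      rw [Metric.mem_closedBall, dist_pi_le_iff (r (fun _ => t)).2.le]
      intro i
      rw [Subsingleton.elim i 0, Real.dist_eq]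
      have h1 := abs_sub_left_of_mem_uIcc (a := t) (b := x) (c := y 0)
        (by rw [uIcc_comm]; exact hy0)
      exact h1.trans hxt
    · intro J hJ
      rw [hπ, TaggedPrepartition.mem_single] at hJ
      subst hJ
      exact mem_Icc_box.2 ⟨min_le_right _ _, le_max_right _ _⟩
  have h := BoxIntegral.Integrable.dist_integralSum_sum_integral_le_of_memBaseSet hf hε hmem
  have hboxes : π.boxes = {intervalBox (min x t) (max x t) hlt} := rfl
  rw [integralSum, hboxes, Finset.sum_singleton, Finset.sum_singleton, hkVol_apply,
    hf.integral_eq hle, Real.dist_eq] at h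
  change |(max x t - min x t) * f t - (hkPrimitive f (max x t) - hkPrimitive f (min x t))| ≤ ε at h
  have h3 := abs_le.1 h
  have h4 := neg_abs_le (f t)
  have h5 := le_abs_self (f t)
  rcases le_total x t with hxt' | hxt'
  · rw [max_eq_right hxt', min_eq_left hxt'] at h3
    rw [abs_of_nonpos (sub_nonpos.2 hxt'), abs_le]
    constructor <;> nlinarith
  · rw [max_eq_left hxt', min_eq_right hxt'] at h3
    rw [abs_of_nonneg (sub_nonneg.2 hxt'), abs_le]
    constructor <;> nlinarith

lemma HKIntegrable.continuousOn_hkPrimitive {f : ℝ → ℝ} (hf : HKIntegrable f) :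
    ContinuousOn (hkPrimitive f) (Icc (-Real.pi) Real.pi) := by
  refine Metric.continuousOn_iff.2 fun t ht ε hε => ?_
  obtain ⟨δ, hδ, h⟩ := hf.abs_sub_le (half_pos (half_pos hε)) ht
  refine ⟨min δ (ε / 2 / (|f t| + 1)), by positivity, fun x hx hxt => ?_⟩
  rw [Real.dist_eq] at hxt ⊢
  refine (h x hx (hxt.le.trans (min_le_left _ _))).trans_lt ?_
  have h1 : |x - t| * (|f t| + 1) ≤ ε / 2 :=
    (le_div_iff₀ (by positivity)).1 (hxt.le.trans (min_le_right _ _))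
  nlinarith [abs_nonneg (x - t)]

/-- The Saks–Henstock lemma with absolute values inside the sum: the boxes with nonnegative and with
negative error form two subpartitions, each contributing at most `ε`. -/
lemma HKIntegrable.sum_abs_sub_le {f : ℝ → ℝ} (hf : HKIntegrable f) {ε : ℝ} (hε : 0 < ε)
    {c : NNReal} {π : TaggedPrepartition periodBox}
    (hπ : IntegrationParams.Henstock.MemBaseSet periodBox c
      (BoxIntegral.Integrable.convergenceR hf ε c) π) :
    ∑ J ∈ π.boxes, |(J.upper 0 - J.lower 0) * f (π.tag J 0)
      - (hkPrimitive f (J.upper 0) - hkPrimitive f (J.lower 0))| ≤ 2 * ε := by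
  classical
  set d : Box (Fin 1) → ℝ := fun J => (J.upper 0 - J.lower 0) * f (π.tag J 0)
      - (hkPrimitive f (J.upper 0) - hkPrimitive f (J.lower 0)) with hd
  have key : ∀ (p : Box (Fin 1) → Prop) [DecidablePred p],
      |∑ J ∈ π.boxes with p J, d J| ≤ ε := fun p _ => by
    have h := BoxIntegral.Integrable.dist_integralSum_sum_integral_le_of_memBaseSet hf hε
      (hπ.filter p)
    have hb : (π.filter p).boxes = π.boxes.filter p := by
      ext J
      exact (π.mem_filter).trans (by simp)
    rw [integralSum, Real.dist_eq, hb, ← Finset.sum_sub_distrib] at h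
    refine le_of_eq_of_le ?_ h
    congr 1
    refine Finset.sum_congr rfl fun J hJ => ?_
    rw [hkVol_apply, hf.integral_eq (π.le_of_mem (Finset.mem_filter.1 hJ).1)]
    rfl
  have h1 := abs_le.1 (key fun J => 0 ≤ d J)
  have h2 := abs_le.1 (key fun J => ¬ 0 ≤ d J)
  rw [← Finset.sum_filter_add_sum_filter_not π.boxes (fun J => 0 ≤ d J)]
  have e1 : ∑ J ∈ π.boxes with 0 ≤ d J, |d J| = ∑ J ∈ π.boxes with 0 ≤ d J, d J :=
    Finset.sum_congr rfl fun J hJ => abs_of_nonneg (Finset.mem_filter.1 hJ).2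
  have e2 : ∑ J ∈ π.boxes with ¬ 0 ≤ d J, |d J| = -∑ J ∈ π.boxes with ¬ 0 ≤ d J, d J := by
    rw [← Finset.sum_neg_distrib]
    exact Finset.sum_congr rfl fun J hJ => abs_of_neg (not_le.1 (Finset.mem_filter.1 hJ).2)
  rw [e1, e2]
  linarith

/-- In the Riemann sum, `f(t)` times the length is replaced by the increment of the primitive, at a
cost controlled by the Saks–Henstock lemma; summation by parts bounds what remains. Only the sup of
the primitive enters, not the size of `f`. -/
lemma HKIntegrable.eventually_abs_integralSum_mul_le {f g : ℝ → ℝ} (hf : HKIntegrable f) {η : ℝ}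
    (hη : ∀ x ∈ Icc (-Real.pi) Real.pi, |hkPrimitive f x| ≤ η) (hg : variation g ≠ ∞) {M : ℝ}
    (hM : ∀ x, |g x| ≤ M) {ε : ℝ} (hε : 0 < ε) :
    ∀ᶠ π in IntegrationParams.Henstock.toFilteriUnion periodBox ⊤,
      |integralSum (fun x : Fin 1 → ℝ => f (x 0) * g (x 0)) hkVol π|
        ≤ η * ((variation g).toReal + M) + ε := by
  have hpi := Real.pi_pos
  have hM0 : 0 ≤ M := (abs_nonneg _).trans (hM 0)
  -- The 2 absorbs the factor in `HKIntegrable.sum_abs_sub_le`; `M + 1` replaces `M`, which may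
  -- vanish.
  set ε' := ε / (2 * (M + 1)) with hε'
  have hε'0 : 0 < ε' := by positivity
  refine (IntegrationParams.Henstock.hasBasis_toFilteriUnion_top periodBox).mem_iff.2
    ⟨BoxIntegral.Integrable.convergenceR hf ε', BoxIntegral.Integrable.convergenceR_cond hf ε', ?_⟩
  rintro π ⟨c, hmem, hpart⟩
  have h1 := hf.sum_abs_sub_le hε'0 hmem
  have h2 := abs_sum_mul_sub_sub_le (ι := Box (Fin 1)) (l := fun J => J.lower 0)
    (t := fun J => π.tag J 0) (u := fun J => J.upper 0) (F := hkPrimitive f) (g := g)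
    (a := -Real.pi) (η := η) (hkPrimitive_neg_pi f) π.boxes (x := Real.pi) (by linarith) hη
    (fun J _ => J.lower_lt_upper 0) (fun J hJ => mem_Icc_box.1 (hmem.isHenstock rfl J hJ))
    (fun J hJ K hK hne => by
      rw [Set.disjoint_left]
      intro y hyJ hyK
      have hJK : Disjoint (J : Set (Fin 1 → ℝ)) K :=
        π.toPrepartition.disjoint_coe_of_mem hJ hK hne
      exact Set.disjoint_left.1 hJK (show (fun _ => y) ∈ (J : Set (Fin 1 → ℝ)) from mem_box.2 hyJ)
        (mem_box.2 hyK))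
    (fun y => by
      constructor
      · rintro ⟨J, hJ, hy⟩
        have h := box_le_iff.1 (π.le_of_mem hJ)
        exact ⟨lt_of_le_of_lt h.1 hy.1, hy.2.trans h.2⟩
      · intro hy
        obtain ⟨J, hJ, hyJ⟩ := hpart (fun _ => y) (mem_box.2 hy)
        exact ⟨J, hJ, mem_box.1 hyJ⟩)
    hg
  have h3 : |g Real.pi * hkPrimitive f Real.pi| ≤ M * η := by
    rw [abs_mul]
    exact mul_le_mul (hM _) (hη _ ⟨by linarith, le_rfl⟩) (abs_nonneg _) hM0
  have h4 : |∑ J ∈ π.boxes, g (π.tag J 0) * ((J.upper 0 - J.lower 0) * f (π.tag J 0)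
      - (hkPrimitive f (J.upper 0) - hkPrimitive f (J.lower 0)))| ≤ ε := by
    refine (Finset.abs_sum_le_sum_abs _ _).trans ?_
    calc _ ≤ ∑ J ∈ π.boxes, M * |(J.upper 0 - J.lower 0) * f (π.tag J 0)
          - (hkPrimitive f (J.upper 0) - hkPrimitive f (J.lower 0))| :=
          Finset.sum_le_sum fun J _ => by
            rw [abs_mul]
            exact mul_le_mul_of_nonneg_right (hM _) (abs_nonneg _)
      _ ≤ M * (2 * ε') := by
          rw [← Finset.mul_sum]
          exact mul_le_mul_of_nonneg_left h1 hM0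
      _ ≤ (M + 1) * (2 * ε') := by nlinarith
      _ = ε := by
          rw [hε']
          field_simp
  have h5 : integralSum (fun x : Fin 1 → ℝ => f (x 0) * g (x 0)) hkVol π
      = ∑ J ∈ π.boxes, g (π.tag J 0) * (hkPrimitive f (J.upper 0) - hkPrimitive f (J.lower 0))
        + ∑ J ∈ π.boxes, g (π.tag J 0) * ((J.upper 0 - J.lower 0) * f (π.tag J 0)
          - (hkPrimitive f (J.upper 0) - hkPrimitive f (J.lower 0))) := by
    rw [integralSum, ← Finset.sum_add_distrib]
    refine Finset.sum_congr rfl fun J _ => ?_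
    rw [hkVol_apply]
    ring
  rw [mem_ofPred_eq, h5]
  change |_| ≤ η * (variation g).toReal at h2
  rw [abs_le] at *
  constructor <;> linarith

/-! ### Lebesgue integrable functions -/

lemma hasIntegral_of_intervalIntegrable {q : ℝ → ℝ} {J : Box (Fin 1)}
    (hq : IntervalIntegrable q volume (J.lower 0) (J.upper 0)) :
    HasIntegral J IntegrationParams.Henstock (fun x : Fin 1 → ℝ => q (x 0)) hkVol
      (∫ x in (J.lower 0)..(J.upper 0), q x) := by
  have hle := (J.lower_lt_upper 0).le
  have hmp := volume_preserving_funUnique (Fin 1) ℝ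
  have hJ : (J : Set (Fin 1 → ℝ))
      = MeasurableEquiv.funUnique (Fin 1) ℝ ⁻¹' Ioc (J.lower 0) (J.upper 0) := by
    ext x
    exact mem_box
  have hint : IntegrableOn (fun x : Fin 1 → ℝ => q (x 0)) J volume := by
    rw [hJ]
    exact (hmp.integrableOn_comp_preimage (MeasurableEquiv.measurableEmbedding _)).2
      ((intervalIntegrable_iff_integrableOn_Ioc_of_le hle).1 hq)
  have h := hint.hasBoxIntegral IntegrationParams.Henstock rfl
  rw [intervalIntegral.integral_of_le hle,
    ← hmp.setIntegral_preimage_emb (MeasurableEquiv.measurableEmbedding _), ← hJ]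
  exact h

lemma hkIntegrable_of_intervalIntegrable {q : ℝ → ℝ}
    (hq : IntervalIntegrable q volume (-Real.pi) Real.pi) : HKIntegrable q :=
  (hasIntegral_of_intervalIntegrable (J := periodBox) hq).integrable

/-- Continuous functions are dense in the Henstock–Kurzweil integrable functions, for the
Alexiewicz norm. -/
lemma HKIntegrable.exists_continuous_near {f : ℝ → ℝ} (hf : HKIntegrable f) {ε : ℝ} (hε : 0 < ε) :
    ∃ p : ℝ → ℝ, Continuous p ∧ HKIntegrable (f - p) ∧
      ∀ x ∈ Icc (-Real.pi) Real.pi, |hkPrimitive (f - p) x| ≤ ε := by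
  have hpi := Real.pi_pos
  -- Weierstrass approximation of the primitive; `p` is the derivative of `P`. The error `ε / 2`
  -- occurs twice, at `x` and at `-π`.
  obtain ⟨P, hP⟩ := exists_polynomial_near_of_continuousOn _ _ _ hf.continuousOn_hkPrimitive
    (ε / 2) (by positivity)
  have hc : Continuous fun x => P.derivative.eval x := P.derivative.continuous
  have hpint := hkIntegrable_of_intervalIntegrable (hc.intervalIntegrable (-Real.pi) Real.pi)
  refine ⟨fun x => P.derivative.eval x, hc, BoxIntegral.Integrable.sub hf hpint, fun x hx => ?_⟩
  rcases hx.1.eq_or_lt with h | h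
  · rw [← h, hkPrimitive_neg_pi, abs_zero]
    exact hε.le
  · have hle := intervalBox_le_periodBox h le_rfl hx.2
    have e1 : hkPrimitive (f - fun x => P.derivative.eval x) x
        = hkPrimitive f x - (P.eval x - P.eval (-Real.pi)) := by
      rw [hkPrimitive, hkPrimitive, dif_pos h, dif_pos h]
      have e2 := (hasIntegral_of_intervalIntegrable (J := intervalBox (-Real.pi) x h)
        (hc.intervalIntegrable _ _)).integral_eq
      have e3 := intervalIntegral.integral_eq_sub_of_hasDerivAt (a := -Real.pi) (b := x)
        (fun y _ => P.hasDerivAt y) (hc.intervalIntegrable _ _)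
      have e4 := BoxIntegral.integral_sub (BoxIntegral.Integrable.to_subbox hf hle)
        (BoxIntegral.Integrable.to_subbox hpint hle)
      rw [e2] at e4
      refine e4.trans ?_
      rw [← e3]
      rfl
    have h1 := abs_lt.1 (hP x hx)
    have h2 := abs_lt.1 (hP (-Real.pi) ⟨le_rfl, by linarith⟩)
    rw [hkPrimitive_neg_pi] at h2
    rw [e1, abs_le]
    constructor <;> linarith

/-! ### Products with functions of bounded variation -/

lemma IsBV.intervalIntegrable {g : ℝ → ℝ} (hg : IsBV g) (a b : ℝ) :
    IntervalIntegrable g volume a b := by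
  obtain ⟨p, q, hp, hq, rfl⟩ := hg.exists_monotone_sub
  exact hp.intervalIntegrable.sub hq.intervalIntegrable

/-- Write `f = (f - p) + p` with `p` continuous and `f - p` of small primitive. The Riemann sums of
`(f - p) g` are eventually small and those of `p g` converge, so those of `f g` are Cauchy. -/
lemma HKIntegrable.mul_isBV {f g : ℝ → ℝ} (hf : HKIntegrable f) (hg : IsBV g) :
    HKIntegrable fun x => f x * g x := by
  have hV : 0 ≤ (variation g).toReal := ENNReal.toReal_nonneg
  set M := |g 0| + (variation g).toReal with hMdef
  have hM0 : 0 ≤ M := by positivity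
  refine BoxIntegral.integrable_iff_cauchy.2 (Metric.cauchy_iff.2 ⟨inferInstance, fun ε hε => ?_⟩)
  set η := ε / (8 * ((variation g).toReal + M + 1)) with hη
  have hη0 : 0 < η := by positivity
  have hηle : η * ((variation g).toReal + M) ≤ ε / 8 := by
    have : η * ((variation g).toReal + M + 1) = ε / 8 := by
      rw [hη]
      field_simp
    nlinarith
  obtain ⟨p, hp, hfp, hsmall⟩ := hf.exists_continuous_near hη0
  have h1 := hfp.eventually_abs_integralSum_mul_le hsmall hg.2.ne hg.abs_le
    (show 0 < ε / 8 by positivity)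
  have hpg : IntervalIntegrable (fun x => p x * g x) volume (-Real.pi) Real.pi :=
    (hg.intervalIntegrable _ _).continuousOn_mul hp.continuousOn
  have h2 := (hasIntegral_of_intervalIntegrable (J := periodBox) hpg).tendsto.eventually
    (Metric.ball_mem_nhds _ (show 0 < ε / 8 by positivity))
  set y := ∫ x in (periodBox.lower 0)..(periodBox.upper 0), p x * g x
  refine ⟨Metric.ball y (ε / 2), ?_, fun a ha b hb => ?_⟩
  · rw [Filter.mem_map]
    filter_upwards [h1, h2] with π hπ1 hπ2
    rw [Real.dist_eq] at hπ2
    rw [mem_preimage, Metric.mem_ball, Real.dist_eq]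
    have hadd := integralSum_add (fun x : Fin 1 → ℝ => (f - p) (x 0) * g (x 0))
      (fun x : Fin 1 → ℝ => p (x 0) * g (x 0)) hkVol π
    have e : (fun x : Fin 1 → ℝ => (f - p) (x 0) * g (x 0))
        + (fun x : Fin 1 → ℝ => p (x 0) * g (x 0)) = fun x => f (x 0) * g (x 0) := by
      funext x
      simp only [Pi.add_apply, Pi.sub_apply]
      ring
    rw [e] at hadd
    change |integralSum (fun x : Fin 1 → ℝ => f (x 0) * g (x 0)) hkVol π - y| < ε / 2
    rw [hadd]
    have h3 := abs_le.1 hπ1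
    have h4 := abs_lt.1 hπ2
    rw [abs_lt]
    constructor <;> linarith
  · have := dist_triangle_right a b y
    rw [Metric.mem_ball] at ha hb
    linarith

lemma HKIntegrable.abs_hkIntegral_mul_le {f g : ℝ → ℝ} (hf : HKIntegrable f) (hg : IsBV g) {η : ℝ}
    (hη : ∀ x ∈ Icc (-Real.pi) Real.pi, |hkPrimitive f x| ≤ η) {M : ℝ} (hM : ∀ x, |g x| ≤ M) :
    |hkIntegral fun x => f x * g x| ≤ η * ((variation g).toReal + M) := by
  refine le_of_forall_pos_le_add fun ε hε => ?_
  have h := BoxIntegral.Integrable.hasIntegral (hf.mul_isBV hg)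
  exact le_of_tendsto h.tendsto.abs (hf.eventually_abs_integralSum_mul_le hη hg.2.ne hM hε)

lemma hkIntegral_mul_eq_add {f p g : ℝ → ℝ} (hp : Continuous p)
    (hfp : HKIntegrable (f - p)) (hg : IsBV g) :
    (hkIntegral fun x => f x * g x)
      = (hkIntegral fun x => (f - p) x * g x) + ∫ x in (-Real.pi)..Real.pi, p x * g x := by
  have hpg : IntervalIntegrable (fun x => p x * g x) volume (-Real.pi) Real.pi :=
    (hg.intervalIntegrable _ _).continuousOn_mul hp.continuousOn
  have h := HasIntegral.add (BoxIntegral.Integrable.hasIntegral (hfp.mul_isBV hg))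
    (hasIntegral_of_intervalIntegrable (J := periodBox) hpg)
  have e : (fun x : Fin 1 → ℝ => (f - p) (x 0) * g (x 0))
      + (fun x : Fin 1 → ℝ => p (x 0) * g (x 0)) = fun x => f (x 0) * g (x 0) := by
    funext x
    simp only [Pi.add_apply, Pi.sub_apply]
    ring
  rw [e] at h
  exact h.integral_eq

/-! ### Weak* convergence of the slices. -/

lemma isBV_slice_poissonIntegral {g : ℝ → ℝ} (hg : IsBV g) {r : ℝ} (hr : r ∈ Ico (0 : ℝ) 1) :
    IsBV (slice (poissonIntegral g) r) :=
  ⟨periodic_slice _ _, (variation_slice_poissonIntegral_le hg hr).trans_lt hg.2⟩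

lemma eventually_mem_Ico_zero_one : ∀ᶠ r in 𝓝[<] (1 : ℝ), r ∈ Ico (0 : ℝ) 1 := by
  filter_upwards [Ioo_mem_nhdsLT (show (0 : ℝ) < 1 by norm_num)] with r hr using ⟨hr.1.le, hr.2⟩

lemma tendsto_integral_mul_slice_poissonIntegral {p g : ℝ → ℝ} (hp : Continuous p) (hg : IsBV g) :
    Tendsto (fun r => ∫ x in (-Real.pi)..Real.pi, p x * slice (poissonIntegral g) r x) (𝓝[<] 1)
      (𝓝 (∫ x in (-Real.pi)..Real.pi, p x * g x)) := by
  refine intervalIntegral.tendsto_integral_filter_of_dominated_convergence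
    (fun x => |p x| * (|g 0| + (variation g).toReal)) ?_ ?_ ?_ ?_
  · filter_upwards [eventually_mem_Ico_zero_one] with r hr
    exact (hp.measurable.mul (isBV_slice_poissonIntegral hg hr).measurable).aestronglyMeasurable
  · filter_upwards [eventually_mem_Ico_zero_one] with r hr
    refine Eventually.of_forall fun x _ => ?_
    rw [norm_mul, Real.norm_eq_abs, Real.norm_eq_abs]
    exact mul_le_mul_of_nonneg_left (abs_slice_poissonIntegral_le hg hg.abs_le hr x) (abs_nonneg _)
  · exact (hp.abs.mul continuous_const).intervalIntegrable _ _
  · have h0 := hg.countable_not_continuousAt.ae_notMem volume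
    filter_upwards [h0] with x hx _
    exact (tendsto_slice_poissonIntegral hg (not_not.1 hx)).const_mul (p x)

/-- The same splitting of `f`: the bound for the remainder `f - p` involves only the sup and the
variation of a slice, both bounded independently of `r`, which leaves the case of continuous `p`. -/
lemma tendsto_hkIntegral_mul_slice_poissonIntegral {f g : ℝ → ℝ} (hf : HKIntegrable f)
    (hg : IsBV g) :
    Tendsto (fun r => hkIntegral fun θ => f θ * slice (poissonIntegral g) r θ) (𝓝[<] 1)
      (𝓝 (hkIntegral fun θ => f θ * g θ)) := by
  have hV : 0 ≤ (variation g).toReal := ENNReal.toReal_nonneg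
  set M := |g 0| + (variation g).toReal with hMdef
  have hM0 : 0 ≤ M := by positivity
  refine Metric.tendsto_nhds.2 fun ε hε => ?_
  set η := ε / (4 * ((variation g).toReal + M + 1)) with hη
  have hη0 : 0 < η := by positivity
  have hηle : η * ((variation g).toReal + M) ≤ ε / 4 := by
    have : η * ((variation g).toReal + M + 1) = ε / 4 := by
      rw [hη]
      field_simp
    nlinarith
  obtain ⟨p, hp, hfp, hsmall⟩ := hf.exists_continuous_near hη0
  filter_upwards [eventually_mem_Ico_zero_one, (Metric.tendsto_nhds.1
    (tendsto_integral_mul_slice_poissonIntegral hp hg)) (ε / 2) (by positivity)] with r hr hr2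
  have hv := isBV_slice_poissonIntegral hg hr
  have hVr := ENNReal.toReal_mono hg.2.ne (variation_slice_poissonIntegral_le hg hr)
  have h1 := abs_le.1 (hfp.abs_hkIntegral_mul_le hg hsmall hg.abs_le)
  have h2 := hfp.abs_hkIntegral_mul_le hv hsmall (abs_slice_poissonIntegral_le hg hg.abs_le hr)
  have h3 := abs_le.1 (h2.trans (mul_le_mul_of_nonneg_left (add_le_add_left hVr _) hη0.le))
  rw [hkIntegral_mul_eq_add hp hfp hg, hkIntegral_mul_eq_add hp hfp hv]
  rw [Real.dist_eq, abs_lt] at hr2 ⊢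
  constructor <;> linarith

end HenstockKurzweil

/-- Lower semicontinuity of the variation under pointwise convergence. The filter is general because
it is applied to sequences, to one-sided limits and to an ultrafilter. -/
lemma variation_le_of_tendsto {ι : Type*} {p : Filter ι} [p.NeBot] {F : ι → ℝ → ℝ} {f : ℝ → ℝ}
    (hF : ∀ x, Tendsto (fun i => F i x) p (𝓝 (f x))) {C : ℝ≥0∞}
    (hC : ∀ᶠ i in p, variation (F i) ≤ C) : variation f ≤ C := by
  by_contra h
  have h1 := eVariationOn.lowerSemicontinuous_aux (s := Icc (-Real.pi) Real.pi)
    (fun x _ => hF x) (not_le.1 h)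
  obtain ⟨i, hi, hi'⟩ := (h1.and hC).exists
  exact absurd hi (not_lt.2 hi')

/-! ### Failure of convergence in variation -/

lemma IsHarmonicOnDisc.continuous_slice {u : Disc → ℝ} (hu : IsHarmonicOnDisc u) {r : ℝ}
    (hr : r ∈ Ico (0 : ℝ) 1) : Continuous (slice u r) := by
  refine continuous_iff_continuousAt.2 fun θ => ?_
  have h := (hu _ (circleMap_mem_ball hr θ)).1.continuousAt
  exact ContinuousAt.comp (f := circleMap 0 r) h (continuous_circleMap 0 r).continuousAt

/-- The slice is continuous at 0, so its difference with `s` has the same jump size there as `s`,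
and the variation is at least this jump. -/
lemma not_tendsto_variation_slice_sub {s : ℝ → ℝ} (hs : IsBV s) {l₁ l₂ : ℝ}
    (h₁ : Tendsto s (𝓝[>] 0) (𝓝 l₁)) (h₂ : Tendsto s (𝓝[<] 0) (𝓝 l₂)) (hne : l₁ ≠ l₂) :
    ¬ Tendsto (fun r => variation (slice (poissonIntegral s) r - s)) (𝓝[<] 1) (𝓝 0) := by
  intro h
  have hpos : 0 < edist l₂ l₁ := edist_pos.2 hne.symm
  obtain ⟨r, hr1, hr⟩ := ((h.eventually_lt_const hpos).and eventually_mem_Ico_zero_one).exists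
  set w := slice (poissonIntegral s) r
  have hw : ContinuousAt w 0 :=
    ((isHarmonicOnDisc_poissonIntegral hs).continuous_slice hr).continuousAt
  have hper : Function.Periodic (w - s) (2 * Real.pi) := (periodic_slice _ _).sub hs.1
  have e1 : Tendsto (w - s) (𝓝[>] 0) (𝓝 (w 0 - l₁)) :=
    (hw.tendsto.mono_left nhdsWithin_le_nhds).sub h₁
  have e2 : Tendsto (w - s) (𝓝[<] 0) (𝓝 (w 0 - l₂)) :=
    (hw.tendsto.mono_left nhdsWithin_le_nhds).sub h₂
  have e3 : ∀ x, edist ((w - s) x) (w 0 - l₂) ≤ variation (w - s) := fun x =>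
    le_of_tendsto (tendsto_const_nhds.edist e2)
      (Eventually.of_forall fun y => edist_le_variation hper x y)
  have e4 : edist (w 0 - l₁) (w 0 - l₂) ≤ variation (w - s) :=
    le_of_tendsto (e1.edist tendsto_const_nhds) (Eventually.of_forall e3)
  rw [edist_sub_left, edist_comm] at e4
  exact absurd hr1 (not_lt.2 e4)

lemma variation_lt_top_of_monotone_sub {p q : ℝ → ℝ} (hp : Monotone p) (hq : Monotone q) :
    variation (p - q) < ∞ := by
  have hpi := Real.pi_pos
  have key : ∀ p : ℝ → ℝ, Monotone p → variation p < ∞ := fun p hp => by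
    have h := (hp.monotoneOn (Icc (-Real.pi) Real.pi)).eVariationOn_eq
      (left_mem_Icc.2 (by linarith)) (right_mem_Icc.2 (by linarith))
    rw [inter_self] at h
    exact h.trans_lt ENNReal.ofReal_lt_top
  rw [sub_eq_add_neg]
  refine (variation_add_le _ _).trans_lt (ENNReal.add_lt_top.2 ⟨key p hp, ?_⟩)
  rw [variation_neg]
  exact key q hq

/-- The phase `(θ + π) / (2π)`. -/
def phase (θ : ℝ) : ℝ := (θ + Real.pi) / (2 * Real.pi)

lemma continuous_phase : Continuous phase := by
  unfold phase
  fun_prop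

lemma strictMono_phase : StrictMono phase := fun x y h =>
  div_lt_div_of_pos_right (by linarith) Real.two_pi_pos

lemma phase_add_two_pi (θ : ℝ) : phase (θ + 2 * Real.pi) = phase θ + 1 := by
  have := Real.pi_pos
  unfold phase
  field_simp
  ring

/-- The square wave of period `2π` built from the step function `m`. -/
def squareWave (m : ℝ → ℝ) (θ : ℝ) : ℝ := m (2 * phase θ) - 2 * m (phase θ)

/-- Over one period the first term of `squareWave` grows by 2 and so does the subtracted one, hence
periodicity; both terms are monotone. -/
lemma isBV_squareWave {m : ℝ → ℝ} (hm : Monotone m) (hm1 : ∀ x, m (x + 1) = m x + 1) :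
    IsBV (squareWave m) := by
  constructor
  · intro θ
    rw [squareWave, squareWave, phase_add_two_pi, mul_add, mul_one, ← one_add_one_eq_two,
      ← add_assoc, hm1, hm1, hm1]
    ring
  · have hmono := strictMono_phase.monotone
    exact variation_lt_top_of_monotone_sub (p := fun θ => m (2 * phase θ))
      (q := fun θ => 2 * m (phase θ))
      (fun x y h => hm (mul_le_mul_of_nonneg_left (hmono h) zero_le_two))
      (fun x y h => mul_le_mul_of_nonneg_left (hm (hmono h)) zero_le_two)

lemma tendsto_squareWave_right {m m' : ℝ → ℝ} (hm : ∀ x, Tendsto m (𝓝[>] x) (𝓝 (m' x))) (θ : ℝ) :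
    Tendsto (squareWave m) (𝓝[>] θ) (𝓝 (squareWave m' θ)) := by
  have h1 : Tendsto phase (𝓝[>] θ) (𝓝[>] (phase θ)) :=
    tendsto_nhdsWithin_iff.2 ⟨continuous_phase.continuousAt.tendsto.mono_left nhdsWithin_le_nhds,
      eventually_nhdsWithin_of_forall fun x hx => strictMono_phase hx⟩
  have h2 : Tendsto (fun θ => 2 * phase θ) (𝓝[>] θ) (𝓝[>] (2 * phase θ)) :=
    tendsto_nhdsWithin_iff.2 ⟨((continuous_phase.const_mul 2).tendsto θ).mono_left
      nhdsWithin_le_nhds, eventually_nhdsWithin_of_forall fun x hx =>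
        mul_lt_mul_of_pos_left (strictMono_phase hx) zero_lt_two⟩
  exact ((hm _).comp h2).sub (((hm _).comp h1).const_mul 2)

lemma tendsto_squareWave_left {m m' : ℝ → ℝ} (hm : ∀ x, Tendsto m (𝓝[<] x) (𝓝 (m' x))) (θ : ℝ) :
    Tendsto (squareWave m) (𝓝[<] θ) (𝓝 (squareWave m' θ)) := by
  have h1 : Tendsto phase (𝓝[<] θ) (𝓝[<] (phase θ)) :=
    tendsto_nhdsWithin_iff.2 ⟨continuous_phase.continuousAt.tendsto.mono_left nhdsWithin_le_nhds,
      eventually_nhdsWithin_of_forall fun x hx => strictMono_phase hx⟩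
  have h2 : Tendsto (fun θ => 2 * phase θ) (𝓝[<] θ) (𝓝[<] (2 * phase θ)) :=
    tendsto_nhdsWithin_iff.2 ⟨((continuous_phase.const_mul 2).tendsto θ).mono_left
      nhdsWithin_le_nhds, eventually_nhdsWithin_of_forall fun x hx =>
        mul_lt_mul_of_pos_left (strictMono_phase hx) zero_lt_two⟩
  exact ((hm _).comp h2).sub (((hm _).comp h1).const_mul 2)

lemma tendsto_floor_nhdsGT (x : ℝ) :
    Tendsto (fun x : ℝ => (⌊x⌋ : ℝ)) (𝓝[>] x) (𝓝 (⌊x⌋ : ℝ)) :=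
  (tendsto_pure_nhds (fun n : ℤ => (n : ℝ)) ⌊x⌋).comp
    ((tendsto_floor_right_pure_floor x).mono_left (nhdsWithin_mono _ Ioi_subset_Ici_self))

lemma tendsto_floor_nhdsLT (x : ℝ) :
    Tendsto (fun x : ℝ => (⌊x⌋ : ℝ)) (𝓝[<] x) (𝓝 ((⌈x⌉ - 1 : ℤ) : ℝ)) :=
  (tendsto_pure_nhds (fun n : ℤ => (n : ℝ)) _).comp (tendsto_floor_left_pure_ceil_sub_one x)

lemma tendsto_ceil_nhdsLT (x : ℝ) :
    Tendsto (fun x : ℝ => (⌈x⌉ : ℝ)) (𝓝[<] x) (𝓝 (⌈x⌉ : ℝ)) :=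
  (tendsto_pure_nhds (fun n : ℤ => (n : ℝ)) ⌈x⌉).comp
    ((tendsto_ceil_left_pure_ceil x).mono_left (nhdsWithin_mono _ Iio_subset_Iic_self))

lemma tendsto_ceil_nhdsGT (x : ℝ) :
    Tendsto (fun x : ℝ => (⌈x⌉ : ℝ)) (𝓝[>] x) (𝓝 ((⌊x⌋ + 1 : ℤ) : ℝ)) :=
  (tendsto_pure_nhds (fun n : ℤ => (n : ℝ)) _).comp (tendsto_ceil_right_pure_floor_add_one x)

lemma phase_zero : phase 0 = 1 / 2 := by
  have := Real.pi_pos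
  unfold phase
  field_simp
  ring

lemma floor_half : ⌊(1 / 2 : ℝ)⌋ = 0 := by
  rw [Int.floor_eq_iff]
  norm_num

lemma ceil_half : ⌈(1 / 2 : ℝ)⌉ = 1 := by
  rw [Int.ceil_eq_iff]
  norm_num

lemma exists_nbv_not_tendsto_variation : ∃ σ ∈ nbv,
    ¬ Tendsto (fun r => variation (slice (poissonIntegral σ) r - σ)) (𝓝[<] 1) (𝓝 0) := by
  have hbv : IsBV (squareWave fun x => (⌊x⌋ : ℝ)) :=
    isBV_squareWave (fun x y h => Int.cast_le.2 (Int.floor_mono h)) fun x => by simp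
  -- With the floor as step function, the wave is 0 on `[-π, 0)` and 1 on `[0, π)`.
  refine ⟨squareWave fun x => (⌊x⌋ : ℝ), ⟨hbv, ?_, fun θ => ?_⟩,
    not_tendsto_variation_slice_sub hbv (tendsto_squareWave_right tendsto_floor_nhdsGT 0)
      (tendsto_squareWave_left tendsto_floor_nhdsLT 0) ?_⟩
  · simp [squareWave, phase]
  · exact continuousWithinAt_Ioi_iff_Ici.1 (tendsto_squareWave_right tendsto_floor_nhdsGT θ)
  · simp only [squareWave, phase_zero, floor_half, ceil_half]
    norm_num

lemma exists_mean_not_tendsto_variation : ∃ τ : ℝ → ℝ, IsBV τ ∧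
    (∀ θ : ℝ, ∃ l₁ l₂ : ℝ, Tendsto τ (𝓝[>] θ) (𝓝 l₁) ∧ Tendsto τ (𝓝[<] θ) (𝓝 l₂) ∧
      τ θ = (l₁ + l₂) / 2) ∧
    ¬ Tendsto (fun r => variation (slice (poissonIntegral τ) r - τ)) (𝓝[<] 1) (𝓝 0) := by
  -- The mean of floor and ceiling is everywhere the mean of its one-sided limits, and `squareWave`
  -- is linear in the step function.
  have hbv : IsBV (squareWave fun x => ((⌊x⌋ : ℝ) + ⌈x⌉) / 2) :=
    isBV_squareWave (fun x y h => by
      have h1 : (⌊x⌋ : ℝ) ≤ ⌊y⌋ := Int.cast_le.2 (Int.floor_mono h)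
      have h2 : (⌈x⌉ : ℝ) ≤ ⌈y⌉ := Int.cast_le.2 (Int.ceil_mono h)
      change ((⌊x⌋ : ℝ) + ⌈x⌉) / 2 ≤ ((⌊y⌋ : ℝ) + ⌈y⌉) / 2
      linarith) fun x => by
        rw [Int.floor_add_one, Int.ceil_add_one]
        push_cast
        ring
  have hr := tendsto_squareWave_right fun x =>
    ((tendsto_floor_nhdsGT x).add (tendsto_ceil_nhdsGT x)).div_const 2
  have hl := tendsto_squareWave_left fun x =>
    ((tendsto_floor_nhdsLT x).add (tendsto_ceil_nhdsLT x)).div_const 2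
  refine ⟨_, hbv, fun θ => ⟨_, _, hr θ, hl θ, ?_⟩,
    not_tendsto_variation_slice_sub hbv (hr 0) (hl 0) ?_⟩
  · simp only [squareWave]
    push_cast
    ring
  · simp only [squareWave, phase_zero, floor_half, ceil_half]
    norm_num

/-! ### The null space of the seminorm of `h^BV` -/

lemma HBV.norm_def (u : HBV) : ‖u‖ = (hardyVariation u.toFun).toReal := rfl

lemma NBV.norm_def (g : NBV) : ‖g‖ = (variation g.toFun).toReal := rfl

lemma variation_slice_le_hardyVariation (u : Disc → ℝ) {r : ℝ} (hr : r ∈ Ico (0 : ℝ) 1) :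
    variation (slice u r) ≤ hardyVariation u :=
  le_iSup₂ (f := fun r (_ : r ∈ Ico (0 : ℝ) 1) => variation (slice u r)) r hr

/-- Vanishing variation makes `u` constant on each circle about 0; by the mean value property that
constant is `u(0)`. -/
lemma HBV.norm_eq_zero_iff (u : HBV) : ‖u‖ = 0 ↔ ∃ c : ℝ, ∀ z : Disc, u.toFun z = c := by
  have hfin : hardyVariation u.toFun ≠ ∞ := u.2.2.ne
  have hharm : IsHarmonicOnDisc u.toFun := u.2.1
  rw [HBV.norm_def, ENNReal.toReal_eq_zero_iff, or_iff_left hfin]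
  constructor
  · intro h
    refine ⟨extendZero u.toFun 0, fun z => ?_⟩
    have hr : ‖(z : ℂ)‖ ∈ Ico (0 : ℝ) 1 := ⟨norm_nonneg _, mem_ball_zero_iff.1 z.2⟩
    have hconst : ∀ θ, slice u.toFun ‖(z : ℂ)‖ θ
        = slice u.toFun ‖(z : ℂ)‖ (Complex.arg z) := fun θ => by
      have h1 := (edist_le_variation (periodic_slice u.toFun ‖(z : ℂ)‖) θ (Complex.arg z)).trans
        (variation_slice_le_hardyVariation u.toFun hr)
      rw [h] at h1
      exact edist_eq_zero.1 (nonpos_iff_eq_zero.1 h1)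
    have hmean := InnerProductSpace.HarmonicOnNhd.circleAverage_eq (c := 0) (R := ‖(z : ℂ)‖)
      (HarmonicOnNhd.mono hharm (Metric.closedBall_subset_ball (by
        rw [abs_of_nonneg hr.1]
        exact hr.2)))
    have h2 : (fun θ => extendZero u.toFun (circleMap 0 ‖(z : ℂ)‖ θ))
        = fun _ => slice u.toFun ‖(z : ℂ)‖ (Complex.arg z) := funext hconst
    have hpi := Real.pi_pos
    rw [Real.circleAverage_def, h2, intervalIntegral.integral_const, sub_zero,
      smul_smul, inv_mul_cancel₀ (by positivity), one_smul, slice_eq hr] at hmean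
    rw [← hmean]
    congr 1
    exact Subtype.ext (circleMap_norm_arg (z : ℂ)).symm
  · rintro ⟨c, hc⟩
    refine nonpos_iff_eq_zero.1 (iSup₂_le fun r hr => ?_)
    have : slice u.toFun r = fun _ => c := funext fun θ => by rw [slice_eq hr, hc]
    rw [this, variation, eVariationOn.constant_on]
    rintro _ ⟨x, -, rfl⟩ _ ⟨y, -, rfl⟩
    rfl

/-! ### Completeness of `NBV` -/

/-- An element of `NBV`, from a function in `nbv`. -/
def NBV.mk (g : ℝ → ℝ) (hg : g ∈ nbv) : NBV := (⟨g, hg⟩ : nbv)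

lemma NBV.toFun_sub (f g : NBV) : (f - g).toFun = f.toFun - g.toFun := rfl

lemma NBV.mem (g : NBV) : g.toFun ∈ nbv := g.2

lemma NBV.abs_le_norm (g : NBV) (x : ℝ) : |g.toFun x| ≤ ‖g‖ := by
  have h := g.mem.1.abs_sub_le x (-Real.pi)
  rwa [g.mem.2.1, sub_zero] at h

/-- Since `g(-π) = 0`, the norm dominates the sup norm, so a Cauchy sequence converges uniformly and
right continuity survives. Lower semicontinuity of the variation upgrades this to convergence in
norm. -/
instance : CompleteSpace NBV := by
  refine Metric.complete_of_cauchySeq_tendsto fun F hF => ?_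
  have hdist : ∀ m n x, dist ((F m).toFun x) ((F n).toFun x) ≤ dist (F m) (F n) := fun m n x => by
    rw [Real.dist_eq, dist_eq_norm]
    exact (F m - F n).abs_le_norm x
  have hpt : ∀ x, ∃ y, Tendsto (fun n => (F n).toFun x) atTop (𝓝 y) := fun x =>
    cauchySeq_tendsto_of_complete (Metric.cauchySeq_iff.2 fun ε hε => by
      obtain ⟨N, hN⟩ := Metric.cauchySeq_iff.1 hF ε hε
      exact ⟨N, fun m hm n hn => (hdist m n x).trans_lt (hN m hm n hn)⟩)
  choose G hG using hpt
  have hvar : ∀ ε > 0, ∃ N, ∀ n ≥ N, variation ((F n).toFun - G) ≤ ENNReal.ofReal ε := by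
    intro ε hε
    obtain ⟨N, hN⟩ := Metric.cauchySeq_iff.1 hF ε hε
    refine ⟨N, fun n hn => variation_le_of_tendsto (p := atTop)
      (F := fun m => (F n).toFun - (F m).toFun) (fun x => tendsto_const_nhds.sub (hG x)) ?_⟩
    filter_upwards [eventually_ge_atTop N] with m hm
    have h := (hN n hn m hm).le
    rw [dist_eq_norm, NBV.norm_def, NBV.toFun_sub] at h
    exact (ENNReal.le_ofReal_iff_toReal_le (F n - F m).mem.1.2.ne hε.le).2 h
  have hper : Function.Periodic G (2 * Real.pi) := fun x =>
    tendsto_nhds_unique (hG _) ((hG x).congr fun n => ((F n).mem.1.1 x).symm)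
  have hGmem : G ∈ nbv := by
    refine ⟨⟨hper, ?_⟩, ?_, fun x => ?_⟩
    · obtain ⟨N, hN⟩ := hvar 1 one_pos
      have h : G = (F N).toFun + -((F N).toFun - G) := by
        funext x
        simp
      rw [h]
      refine (variation_add_le _ _).trans_lt (ENNReal.add_lt_top.2 ⟨(F N).mem.1.2, ?_⟩)
      rw [variation_neg]
      exact (hN N le_rfl).trans_lt ENNReal.ofReal_lt_top
    · exact tendsto_nhds_unique (hG _)
        (tendsto_const_nhds.congr fun n => ((F n).mem.2.1).symm)
    · have hunif : TendstoUniformly (fun n => (F n).toFun) G atTop := by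
        refine Metric.tendstoUniformly_iff.2 fun ε hε => ?_
        obtain ⟨N, hN⟩ := Metric.cauchySeq_iff.1 hF (ε / 2) (by positivity)
        filter_upwards [eventually_ge_atTop N] with n hn x
        refine lt_of_le_of_lt (le_of_tendsto ((hG x).dist tendsto_const_nhds) ?_)
          (half_lt_self hε)
        filter_upwards [eventually_ge_atTop N] with m hm
        exact (hdist m n x).trans (hN m hm n hn).le
      exact hunif.tendsto_of_eventually_tendsto
        (Eventually.of_forall fun n => (F n).mem.2.2 x) (hG x)
  refine ⟨NBV.mk G hGmem, Metric.tendsto_atTop.2 fun ε hε => ?_⟩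
  obtain ⟨N, hN⟩ := hvar (ε / 2) (by positivity)
  refine ⟨N, fun n hn => lt_of_le_of_lt ?_ (half_lt_self hε)⟩
  rw [dist_eq_norm]
  exact ENNReal.toReal_le_of_le_ofReal (by positivity) (hN n hn)

/-! ### The Poisson integral is isometric -/

lemma tendsto_comp_add_nhdsGT {g : ℝ → ℝ} {x l : ℝ} (h : Tendsto g (𝓝[>] x) (𝓝 l)) :
    Tendsto (fun ε => g (x + ε)) (𝓝[>] 0) (𝓝 l) := by
  refine h.comp (tendsto_nhdsWithin_iff.2 ⟨?_, eventually_nhdsWithin_of_forall fun ε hε => ?_⟩)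
  · have h1 : Tendsto (fun ε => x + ε) (𝓝 0) (𝓝 (x + 0)) := Continuous.tendsto (by fun_prop) 0
    rw [add_zero] at h1
    exact h1.mono_left nhdsWithin_le_nhds
  · rw [mem_Ioi] at hε ⊢
    linarith

/-- Slices are known to converge only at continuity points of `g`. The partition is therefore
shifted right by a small `ε` so as to avoid the discontinuities; first `r → 1`, then `ε → 0` by
right continuity. -/
lemma variation_le_of_forall_slice_poissonIntegral {g : ℝ → ℝ} (hg : IsBV g)
    (hright : ∀ x, ContinuousWithinAt g (Ici x) x) {C : ℝ≥0∞}
    (hC : ∀ r ∈ Ico (0 : ℝ) 1, variation (slice (poissonIntegral g) r) ≤ C) :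
    variation g ≤ C := by
  refine iSup_le fun p => ?_
  obtain ⟨n, u, hu, hus⟩ := p
  simp only
  -- The bad shifts, which move some partition point onto a discontinuity. They are countable, so
  -- good shifts accumulate at 0 from the right.
  set N : Set ℝ := ⋃ k, (fun d => d - u k) '' {x | ¬ContinuousAt g x} with hN
  have hNc : N.Countable := countable_iUnion fun k => hg.countable_not_continuousAt.image _
  have hne : (𝓝[Ioi 0 ∩ Nᶜ] (0 : ℝ)).NeBot := by
    rw [← mem_closure_iff_nhdsWithin_neBot]
    have h1 : Ioi (0 : ℝ) ⊆ closure (Ioi 0 ∩ Nᶜ) :=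
      (hNc.dense_compl ℝ).open_subset_closure_inter isOpen_Ioi
    have h2 := closure_mono h1
    rw [closure_closure, closure_Ioi] at h2
    exact h2 self_mem_Ici
  have hlim : ∀ k, Tendsto (fun ε => g (u k + ε)) (𝓝[Ioi 0 ∩ Nᶜ] 0) (𝓝 (g (u k))) := fun k =>
    (tendsto_comp_add_nhdsGT ((hright (u k)).mono Ioi_subset_Ici_self)).mono_left
      (nhdsWithin_mono _ inter_subset_left)
  refine le_of_tendsto (tendsto_finsetSum (Finset.range n) fun i _ =>
    (hlim (i + 1)).edist (hlim i)) (eventually_nhdsWithin_of_forall fun ε hε => ?_)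
  have hcont : ∀ k, ContinuousAt g (u k + ε) := fun k => by
    by_contra h
    exact hε.2 (mem_iUnion.2 ⟨k, u k + ε, h, by ring⟩)
  refine le_of_tendsto (tendsto_finsetSum (Finset.range n) fun i _ =>
    (tendsto_slice_poissonIntegral hg (hcont (i + 1))).edist
      (tendsto_slice_poissonIntegral hg (hcont i))) ?_
  filter_upwards [eventually_mem_Ico_zero_one] with r hr
  refine le_trans ?_ (hC r hr)
  rw [← variation_comp_add_const (periodic_slice _ r) ε]
  exact eVariationOn.sum_le (f := fun x => slice (poissonIntegral g) r (x + ε)) hu hus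

lemma hardyVariation_poissonIntegral_le {g : ℝ → ℝ} (hg : IsBV g) :
    hardyVariation (poissonIntegral g) ≤ variation g :=
  iSup₂_le fun _ hr => variation_slice_poissonIntegral_le hg hr

lemma hardyVariation_poissonIntegral {g : ℝ → ℝ} (hg : g ∈ nbv) :
    hardyVariation (poissonIntegral g) = variation g :=
  le_antisymm (hardyVariation_poissonIntegral_le hg.1)
    (variation_le_of_forall_slice_poissonIntegral hg.1 hg.2.2 fun _ hr =>
      variation_slice_le_hardyVariation _ hr)

lemma poissonIntegral_mem_hbv {g : ℝ → ℝ} (hg : IsBV g) : poissonIntegral g ∈ hbv :=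
  ⟨isHarmonicOnDisc_poissonIntegral hg, (hardyVariation_poissonIntegral_le hg).trans_lt hg.2⟩

lemma norm_mem_Ico (z : Disc) : ‖(z : ℂ)‖ ∈ Ico (0 : ℝ) 1 :=
  ⟨norm_nonneg _, mem_ball_zero_iff.1 z.2⟩

lemma poissonIntegral_integrable {g : ℝ → ℝ} (hg : IsBV g) (z : Disc) :
    IntervalIntegrable (fun φ => g φ * polarPoissonKernel ‖(z : ℂ)‖ (φ - Complex.arg (z : ℂ)))
      volume (-Real.pi) Real.pi :=
  (hg.intervalIntegrable _ _).mul_continuousOn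
    ((continuous_polarPoissonKernel (norm_mem_Ico z)).comp (continuous_sub_right _)).continuousOn

lemma poissonIntegral_add {f g : ℝ → ℝ} (hf : IsBV f) (hg : IsBV g) :
    poissonIntegral (f + g) = poissonIntegral f + poissonIntegral g := by
  funext z
  rw [Pi.add_apply, poissonIntegral, poissonIntegral, poissonIntegral,
    ← intervalIntegral.integral_add (poissonIntegral_integrable hf z)
      (poissonIntegral_integrable hg z)]
  simp only [Pi.add_apply, add_mul]

lemma poissonIntegral_smul (c : ℝ) (g : ℝ → ℝ) :
    poissonIntegral (c • g) = c • poissonIntegral g := by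
  funext z
  rw [Pi.smul_apply, poissonIntegral, poissonIntegral, smul_eq_mul,
    ← intervalIntegral.integral_const_mul]
  simp only [Pi.smul_apply, smul_eq_mul, mul_assoc]

lemma isBV_const (c : ℝ) : IsBV fun _ => c := by
  refine ⟨fun _ => rfl, ?_⟩
  rw [variation, eVariationOn.constant_on]
  · exact ENNReal.zero_lt_top
  · rintro _ ⟨x, -, rfl⟩ _ ⟨y, -, rfl⟩
    rfl

lemma poissonIntegral_const (c : ℝ) (z : Disc) : poissonIntegral (fun _ => c) z = c := by
  have hz : z = ⟨circleMap 0 ‖(z : ℂ)‖ (Complex.arg z), circleMap_mem_ball (norm_mem_Ico z) _⟩ :=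
    Subtype.ext (circleMap_norm_arg (z : ℂ)).symm
  rw [hz, ← slice_eq (norm_mem_Ico z) (poissonIntegral fun _ => c),
    slice_poissonIntegral (fun _ => rfl) (norm_mem_Ico z), intervalIntegral.integral_const_mul,
    integral_polarPoissonKernel (norm_mem_Ico z), mul_one]

/-! ### Right continuous modification -/

/-- The modification is the right limit of `g`. As a limit of the translates `g(· + ε)`, it inherits
periodicity and the bound on the variation. -/
lemma IsBV.exists_right_continuous {g : ℝ → ℝ} (hg : IsBV g) :
    ∃ g' : ℝ → ℝ, IsBV g' ∧ (∀ x, ContinuousWithinAt g' (Ici x) x) ∧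
      ∀ x, ContinuousAt g x → g' x = g x := by
  obtain ⟨p, q, hp, hq, hpq⟩ := hg.exists_monotone_sub
  set g' : ℝ → ℝ := fun x => hp.stieltjesFunction x - hq.stieltjesFunction x with hg'
  have hlim : ∀ x, Tendsto g (𝓝[>] x) (𝓝 (g' x)) := fun x => by
    rw [hpq]
    exact (hp.tendsto_rightLim x).sub (hq.tendsto_rightLim x)
  refine ⟨g', ⟨fun x => ?_, ?_⟩, fun x => ?_, fun x hx => ?_⟩
  · refine tendsto_nhds_unique (tendsto_comp_add_nhdsGT (hlim (x + 2 * Real.pi)))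
      ((tendsto_comp_add_nhdsGT (hlim x)).congr fun ε => ?_)
    rw [← hg.1 (x + ε)]
    congr 1
    ring
  · refine lt_of_le_of_lt (variation_le_of_tendsto (p := 𝓝[>] (0 : ℝ))
      (F := fun ε x => g (x + ε)) (fun x => tendsto_comp_add_nhdsGT (hlim x))
      (Eventually.of_forall fun ε => (variation_comp_add_const hg.1 ε).le)) hg.2
  · exact (hp.stieltjesFunction.right_continuous x).sub (hq.stieltjesFunction.right_continuous x)
  · exact tendsto_nhds_unique (hlim x) (hx.tendsto.mono_left nhdsWithin_le_nhds)

lemma poissonIntegral_congr {f g : ℝ → ℝ} (hg : IsBV g)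
    (h : ∀ x, ContinuousAt g x → f x = g x) : poissonIntegral f = poissonIntegral g := by
  funext z
  refine intervalIntegral.integral_congr_ae ?_
  filter_upwards [hg.countable_not_continuousAt.ae_notMem volume] with x hx _
  rw [h x (not_not.1 hx)]

lemma IsBV.exists_nbv_poissonIntegral_eq {g : ℝ → ℝ} (hg : IsBV g) :
    ∃ σ ∈ nbv, ∃ c : ℝ, ∀ z, poissonIntegral g z = poissonIntegral σ z + c := by
  obtain ⟨g', hg', hright, heq⟩ := hg.exists_right_continuous
  set c := g' (-Real.pi)
  have hσ : IsBV (g' + fun _ => -c) :=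
    ⟨hg'.1.add (fun _ => rfl), (variation_add_le _ _).trans_lt
      (ENNReal.add_lt_top.2 ⟨hg'.2, (isBV_const (-c)).2⟩)⟩
  refine ⟨g' + fun _ => -c, ⟨hσ, by simp [c], fun x => (hright x).add continuousWithinAt_const⟩,
    c, fun z => ?_⟩
  rw [poissonIntegral_add hg' (isBV_const _), poissonIntegral_congr hg heq, Pi.add_apply,
    poissonIntegral_const]
  ring

/-! ### Every function of `h^BV` is a Poisson integral -/

/-- Riemann sums of `h * K` converge at a rate controlled by the variation of `h`. -/
lemma IsBV.abs_integral_mul_sub_sum_le {h K : ℝ → ℝ} (hh : IsBV h) (hK : Continuous K) {C : ℝ}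
    (hC : ∀ x, |K x| ≤ C) {Δ : ℝ} (hΔ : 0 < Δ) {n : ℕ} (hn : n * Δ = 2 * Real.pi) :
    |(∫ x in (-Real.pi)..Real.pi, h x * K x) - ∑ k ∈ Finset.range n, h (-Real.pi + k * Δ) *
        ∫ x in (-Real.pi + k * Δ)..(-Real.pi + (k + 1 : ℕ) * Δ), K x|
      ≤ C * Δ * (variation h).toReal := by
  set x : ℕ → ℝ := fun k => -Real.pi + k * Δ with hx
  have hxs : ∀ k, x (k + 1) = x k + Δ := fun k => by
    simp only [hx]
    push_cast
    ring
  have hxm : Monotone x := monotone_nat_of_le_succ fun k => by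
    rw [hxs]
    linarith
  have hx0 : x 0 = -Real.pi := by simp [hx]
  have hxn : x n = Real.pi := by
    simp only [hx, hn]
    ring
  have hint : ∀ a b, IntervalIntegrable (fun y => h y * K y) volume a b := fun a b =>
    (hh.intervalIntegrable a b).mul_continuousOn hK.continuousOn
  have hfin : ∀ a b, eVariationOn h (Icc a b) ≠ ∞ := fun a b => (hh.eVariationOn_Icc_lt_top a b).ne
  have hsum := intervalIntegral.sum_integral_adjacent_intervals (μ := volume)
    (f := fun y => h y * K y) (a := x) (n := n) fun k _ => hint _ _
  have hvar := eVariationOn.sum' h hxm (n := n)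
  rw [hx0, hxn] at hsum hvar
  rw [← hsum, ← Finset.sum_sub_distrib, variation, ← hvar,
    ENNReal.toReal_sum fun k _ => hfin _ _, Finset.mul_sum]
  refine (Finset.abs_sum_le_sum_abs _ _).trans (Finset.sum_le_sum fun k _ => ?_)
  have hC0 : 0 ≤ C := (abs_nonneg _).trans (hC 0)
  have hle : x k ≤ x (k + 1) := hxm k.le_succ
  change |(∫ y in x k..x (k + 1), h y * K y) - h (x k) * ∫ y in x k..x (k + 1), K y| ≤ _
  rw [← intervalIntegral.integral_const_mul, ← intervalIntegral.integral_sub (hint _ _)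
    ((hK.intervalIntegrable _ _).const_mul _)]
  have key := intervalIntegral.norm_integral_le_of_norm_le_const (a := x k) (b := x (k + 1))
    (f := fun y => h y * K y - h (x k) * K y)
    (C := (eVariationOn h (Icc (x k) (x (k + 1)))).toReal * C) fun y hy => by
      rw [uIoc_of_le hle] at hy
      rw [← sub_mul, norm_mul]
      refine mul_le_mul ?_ (hC y) (norm_nonneg _) ENNReal.toReal_nonneg
      rw [← dist_eq_norm]
      exact BoundedVariationOn.dist_le (hfin _ _) ⟨hy.1.le, hy.2⟩ (left_mem_Icc.2 hle)
  rw [Real.norm_eq_abs, hxs, add_sub_cancel_left, abs_of_pos hΔ, ← hxs] at key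
  linarith

/-- Pointwise convergence with uniformly bounded variations implies convergence of integrals,
along an arbitrary filter. -/
lemma tendsto_integral_mul_of_variation_le {ι : Type*} {l : Filter ι} {h : ι → ℝ → ℝ} {g : ℝ → ℝ}
    {V : ℝ≥0∞} (hV : V ≠ ∞) (hper : ∀ i, Function.Periodic (h i) (2 * Real.pi))
    (hh : ∀ᶠ i in l, variation (h i) ≤ V) (hg : IsBV g) (hgV : variation g ≤ V)
    (hlim : ∀ x, Tendsto (fun i => h i x) l (𝓝 (g x))) {K : ℝ → ℝ} (hK : Continuous K) {C : ℝ}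
    (hC : ∀ x, |K x| ≤ C) :
    Tendsto (fun i => ∫ x in (-Real.pi)..Real.pi, h i x * K x) l
      (𝓝 (∫ x in (-Real.pi)..Real.pi, g x * K x)) := by
  have hpi := Real.two_pi_pos
  have hC0 : 0 ≤ C := (abs_nonneg _).trans (hC 0)
  have hV0 : 0 ≤ V.toReal := ENNReal.toReal_nonneg
  refine Metric.tendsto_nhds.2 fun ε hε => ?_
  -- The mesh makes the Riemann sum error less than `ε / 3` for all functions of variation at most
  -- `V` at once, so only finitely many pointwise limits are needed. Dominated convergence would not
  -- cover an ultrafilter.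
  obtain ⟨n, hn⟩ := exists_nat_gt (C * (2 * Real.pi) * V.toReal / (ε / 3))
  have hn0 : (0 : ℝ) < n := lt_of_le_of_lt (by positivity) hn
  set Δ := 2 * Real.pi / n with hΔ
  have hΔ0 : 0 < Δ := by positivity
  have hnΔ : n * Δ = 2 * Real.pi := by
    rw [hΔ]
    field_simp
  have hsmall : C * Δ * V.toReal < ε / 3 := by
    rw [div_lt_iff₀ (by positivity)] at hn
    have : C * Δ * V.toReal = C * (2 * Real.pi) * V.toReal / n := by
      rw [hΔ]
      ring
    rw [this, div_lt_iff₀ hn0]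
    linarith
  have hb : ∀ f : ℝ → ℝ, variation f ≤ V → C * Δ * (variation f).toReal < ε / 3 := fun f hf =>
    lt_of_le_of_lt (mul_le_mul_of_nonneg_left (ENNReal.toReal_mono hV hf) (by positivity)) hsmall
  have hS := tendsto_finsetSum (Finset.range n) fun k _ => (hlim (-Real.pi + k * Δ)).mul_const
    (∫ x in (-Real.pi + k * Δ)..(-Real.pi + (k + 1 : ℕ) * Δ), K x)
  filter_upwards [hh, Metric.tendsto_nhds.1 hS (ε / 3) (by positivity)] with i hi hSi
  have h1 := (IsBV.abs_integral_mul_sub_sum_le ⟨hper i, hi.trans_lt hV.lt_top⟩ hK hC hΔ0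
    hnΔ).trans_lt (hb _ hi)
  have h2 := (hg.abs_integral_mul_sub_sum_le hK hC hΔ0 hnΔ).trans_lt (hb _ hgV)
  rw [Real.dist_eq] at hSi ⊢
  rw [abs_lt] at *
  constructor <;> linarith

lemma abs_polarPoissonKernel_le {r : ℝ} (hr : r ∈ Ico (0 : ℝ) 1) (θ : ℝ) :
    |polarPoissonKernel r θ| ≤ (1 - r ^ 2) / (2 * Real.pi * (1 - r) ^ 2) := by
  have hpi := Real.pi_pos
  have h1 : 0 < 1 - r := sub_pos.2 hr.2
  rw [abs_of_nonneg (polarPoissonKernel_nonneg hr θ), polarPoissonKernel]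
  refine div_le_div_of_nonneg_left (by nlinarith [hr.1]) (by positivity)
    (mul_le_mul_of_nonneg_left ?_ (by positivity))
  nlinarith [mul_nonneg hr.1 (sub_nonneg.2 (Real.cos_le_one θ))]

/-- Helly's selection, by compactness along an ultrafilter. The slices themselves need not obviously
be bounded, so their values at 0 are subtracted first. -/
lemma exists_isBV_eq_poissonIntegral_add {u : Disc → ℝ} (hu : u ∈ hbv) :
    ∃ g : ℝ → ℝ, IsBV g ∧ ∃ c : ℝ, ∀ z, u z = poissonIntegral g z + c := by
  obtain ⟨hharm, hfin⟩ := hu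
  set V := hardyVariation u with hV
  obtain ⟨l, hl⟩ := Ultrafilter.exists_le (𝓝[<] (1 : ℝ))
  have hlr : ∀ᶠ r in (l : Filter ℝ), r ∈ Ioo (0 : ℝ) 1 :=
    hl (Ioo_mem_nhdsLT (show (0 : ℝ) < 1 by norm_num))
  set h : ℝ → ℝ → ℝ := fun r => slice u r + fun _ => -slice u r 0 with hh
  have hper : ∀ r, Function.Periodic (h r) (2 * Real.pi) := fun r =>
    (periodic_slice u r).add fun _ => rfl
  have hcv : ∀ c : ℝ, variation (fun _ => c) = 0 := fun c => eVariationOn.constant_on (by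
    rintro _ ⟨x, -, rfl⟩ _ ⟨y, -, rfl⟩
    rfl)
  have hvar : ∀ r ∈ Ico (0 : ℝ) 1, variation (h r) ≤ V := fun r hr =>
    (variation_add_le _ _).trans (by
      rw [hcv, add_zero]
      exact variation_slice_le_hardyVariation u hr)
  have hvar' : ∀ᶠ r in (l : Filter ℝ), variation (h r) ≤ V :=
    hlr.mono fun r hr => hvar r (Ioo_subset_Ico_self hr)
  have hpt : ∀ x, ∃ y, Tendsto (fun r => h r x) l (𝓝 y) := fun x => by
    have hmem : ∀ᶠ r in (l : Filter ℝ), h r x ∈ Icc (-V.toReal) V.toReal := by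
      filter_upwards [hlr] with r hr
      have h1 := IsBV.abs_sub_le ⟨periodic_slice u r, (variation_slice_le_hardyVariation u
        (Ioo_subset_Ico_self hr)).trans_lt hfin⟩ x 0
      exact abs_le.1 (h1.trans (ENNReal.toReal_mono hfin.ne
        (variation_slice_le_hardyVariation u (Ioo_subset_Ico_self hr))))
    obtain ⟨y, -, hy⟩ := isCompact_iff_ultrafilter_le_nhds'.1 isCompact_Icc
      (Ultrafilter.map (fun r => h r x) l) hmem
    exact ⟨y, hy⟩
  choose g hg using hpt
  have hgV : variation g ≤ V := variation_le_of_tendsto hg hvar'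
  have hgBV : IsBV g := ⟨fun x => tendsto_nhds_unique (hg _)
    ((hg x).congr fun r => (hper r x).symm), hgV.trans_lt hfin⟩
  -- `u(r z) = P[h r](z) + u_r(0)`, and the first two of these terms converge. The limit of `u_r(0)`
  -- does not involve `z`, so `u - P[g]` is constant.
  have hlim : ∀ z, Tendsto (fun r => slice u r 0) l (𝓝 (u z - poissonIntegral g z)) := fun z => by
    have h1 : Tendsto (fun r : ℝ => extendZero u (r * z)) l (𝓝 (u z)) := by
      have hz : extendZero u z = u z := dif_pos z.2
      rw [← hz]
      have hca : ContinuousAt (extendZero u) (z : ℂ) := (hharm _ z.2).1.continuousAt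
      refine hca.tendsto.comp ?_
      have h2 : Tendsto (fun r : ℝ => (r : ℂ) * z) (𝓝 1) (𝓝 (((1 : ℝ) : ℂ) * z)) :=
        Continuous.tendsto (by fun_prop) 1
      rw [Complex.ofReal_one, one_mul] at h2
      exact h2.mono_left (hl.trans nhdsWithin_le_nhds)
    have h2 : Tendsto (fun r => poissonIntegral (h r) z) l (𝓝 (poissonIntegral g z)) :=
      tendsto_integral_mul_of_variation_le hfin.ne hper hvar' hgBV hgV hg
        ((continuous_polarPoissonKernel (norm_mem_Ico z)).comp (continuous_sub_right _))
        fun _ => abs_polarPoissonKernel_le (norm_mem_Ico z) _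
    refine (h1.sub h2).congr' (hlr.mono fun r hr => ?_)
    rw [hharm.extendZero_eq hr, poissonIntegral_add ⟨periodic_slice u r,
      (variation_slice_le_hardyVariation u (Ioo_subset_Ico_self hr)).trans_lt hfin⟩
      (isBV_const _), Pi.add_apply, poissonIntegral_const]
    ring
  refine ⟨g, hgBV, u ⟨0, by simp⟩ - poissonIntegral g ⟨0, by simp⟩, fun z => ?_⟩
  have := tendsto_nhds_unique (hlim z) (hlim ⟨0, by simp⟩)
  linarith

/-! ### The isometric isomorphism -/

/-- The Poisson integral, as a linear map into the functions of `h^BV`. -/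
def poissonHBV : NBV →ₗ[ℝ] HBV where
  toFun g := (⟨poissonIntegral g.toFun, poissonIntegral_mem_hbv g.mem.1⟩ : hbv)
  map_add' f g := Subtype.ext (poissonIntegral_add f.mem.1 g.mem.1)
  map_smul' c g := Subtype.ext (poissonIntegral_smul c g.toFun)

lemma toFun_poissonHBV (g : NBV) : (poissonHBV g).toFun = poissonIntegral g.toFun := rfl

lemma norm_poissonHBV (g : NBV) : ‖poissonHBV g‖ = ‖g‖ := by
  rw [HBV.norm_def, NBV.norm_def, toFun_poissonHBV, hardyVariation_poissonIntegral g.mem]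

/-- The Poisson integral, as a linear isometry into the normed space belonging to `h^BV`. -/
def poissonIsometry : NBV →ₗᵢ[ℝ] SeparationQuotient HBV where
  toLinearMap := (SeparationQuotient.mkCLM ℝ HBV).toLinearMap.comp poissonHBV
  norm_map' g := (SeparationQuotient.norm_mk (poissonHBV g)).trans (norm_poissonHBV g)

lemma poissonIsometry_apply (g : NBV) :
    poissonIsometry g = SeparationQuotient.mk (poissonHBV g) := rfl

/-- Two constants arise, one from the Helly argument and one from normalising `g` at `-π`; both
vanish in the quotient. -/
lemma poissonIsometry_surjective : Function.Surjective poissonIsometry := by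
  intro x
  obtain ⟨u, rfl⟩ := SeparationQuotient.surjective_mk x
  obtain ⟨g, hg, c, hc⟩ := exists_isBV_eq_poissonIntegral_add u.2
  obtain ⟨σ, hσ, c', hc'⟩ := hg.exists_nbv_poissonIntegral_eq
  refine ⟨NBV.mk σ hσ, ?_⟩
  rw [poissonIsometry_apply, SeparationQuotient.mk_eq_mk, Metric.inseparable_iff, dist_comm,
    dist_eq_norm, HBV.norm_eq_zero_iff]
  refine ⟨c' + c, fun z => ?_⟩
  change u.toFun z - poissonIntegral σ z = c' + c
  have h1 : u.toFun z = _ := hc z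
  rw [h1, hc']
  ring

end PoissonBV

end

theorem mainTheorem8 :
    -- (a) weak* convergence in `NBV`: convergence of the pairing with every `f` in `HK`
    (∀ g ∈ PoissonBV.nbv, ∀ f : ℝ → ℝ, PoissonBV.IsHK f →
      PoissonBV.HKIntegrable (fun θ => f θ * g θ) ∧
      (∀ r ∈ Ico (0 : ℝ) 1, PoissonBV.HKIntegrable
        (fun θ => f θ * PoissonBV.slice (PoissonBV.poissonIntegral g) r θ)) ∧
      Tendsto (fun r => PoissonBV.hkIntegral
          (fun θ => f θ * PoissonBV.slice (PoissonBV.poissonIntegral g) r θ))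
        (𝓝[<] 1) (𝓝 (PoissonBV.hkIntegral (fun θ => f θ * g θ)))) ∧
    -- (b)
    (∀ g : ℝ → ℝ, PoissonBV.IsBV g → ∀ r ∈ Ico (0 : ℝ) 1,
      (⨆ θ : ℝ, ‖PoissonBV.slice (PoissonBV.poissonIntegral g) r θ‖ₑ)
        ≤ (⨅ θ : ℝ, ‖g θ‖ₑ) + PoissonBV.variation g) ∧
    -- (c)
    (∀ g ∈ PoissonBV.nbv, ∀ r ∈ Ico (0 : ℝ) 1,
      (⨆ θ : ℝ, ‖PoissonBV.slice (PoissonBV.poissonIntegral g) r θ‖ₑ)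
        ≤ PoissonBV.variation g) ∧
    -- (d)
    (∀ g : ℝ → ℝ, PoissonBV.IsBV g → ∀ r ∈ Ico (0 : ℝ) 1,
      PoissonBV.variation (PoissonBV.slice (PoissonBV.poissonIntegral g) r)
        ≤ PoissonBV.variation g) ∧
    -- (e) convergence in variation can fail, in `NBV` ...
    (∃ σ ∈ PoissonBV.nbv,
      ¬ Tendsto (fun r => PoissonBV.variation
          (PoissonBV.slice (PoissonBV.poissonIntegral σ) r - σ)) (𝓝[<] 1) (𝓝 0)) ∧
    -- ... and for a function that is everywhere the mean of its one-sided limits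
    (∃ τ : ℝ → ℝ, PoissonBV.IsBV τ ∧
      (∀ θ : ℝ, ∃ l₁ l₂ : ℝ, Tendsto τ (𝓝[>] θ) (𝓝 l₁) ∧ Tendsto τ (𝓝[<] θ) (𝓝 l₂) ∧
        τ θ = (l₁ + l₂) / 2) ∧
      ¬ Tendsto (fun r => PoissonBV.variation
          (PoissonBV.slice (PoissonBV.poissonIntegral τ) r - τ)) (𝓝[<] 1) (𝓝 0)) ∧
    -- (f) the null space of the seminorm of `h^BV` consists of the constants; modulo these,
    -- `g ↦ P[g]` is an isometric isomorphism of the Banach spaces `NBV` and `h^BV`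
    (∀ u : PoissonBV.HBV, ‖u‖ = 0 ↔ ∃ c : ℝ, ∀ z : PoissonBV.Disc, u.toFun z = c) ∧
    CompleteSpace PoissonBV.NBV ∧
    CompleteSpace (SeparationQuotient PoissonBV.HBV) ∧
    (∃ T : PoissonBV.NBV ≃ₗᵢ[ℝ] SeparationQuotient PoissonBV.HBV,
      ∀ g : PoissonBV.NBV, ∃ u : PoissonBV.HBV,
        u.toFun = PoissonBV.poissonIntegral g.toFun ∧ T g = SeparationQuotient.mk u) := by
  refine ⟨fun g hg f hf => ⟨hf.2.mul_isBV hg.1, fun r hr => hf.2.mul_isBV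
      (PoissonBV.isBV_slice_poissonIntegral hg.1 hr),
      PoissonBV.tendsto_hkIntegral_mul_slice_poissonIntegral hf.2 hg.1⟩,
    fun g hg r hr => PoissonBV.iSup_enorm_slice_poissonIntegral_le hg hr,
    fun g hg r hr => ?_, fun g hg r hr => PoissonBV.variation_slice_poissonIntegral_le hg hr,
    PoissonBV.exists_nbv_not_tendsto_variation, PoissonBV.exists_mean_not_tendsto_variation,
    PoissonBV.HBV.norm_eq_zero_iff, inferInstance, ?_, ?_⟩
  · refine (PoissonBV.iSup_enorm_slice_poissonIntegral_le hg.1 hr).trans ?_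
    have h : (⨅ θ : ℝ, ‖g θ‖ₑ) ≤ 0 := (iInf_le _ (-Real.pi)).trans (by simp [hg.2.1])
    rw [nonpos_iff_eq_zero.1 h, zero_add]
  -- Completeness is carried over from `NBV` along the isometry.
  · exact (LinearIsometryEquiv.ofSurjective PoissonBV.poissonIsometry
      PoissonBV.poissonIsometry_surjective).toIsometryEquiv.symm.completeSpace
  · exact ⟨LinearIsometryEquiv.ofSurjective PoissonBV.poissonIsometry
      PoissonBV.poissonIsometry_surjective, fun g => ⟨PoissonBV.poissonHBV g, rfl, rfl⟩⟩
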